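/- Let $X$ be a simplicial set, let $\Delta\downarrow X$ be its category of simplices (objects: simplicial maps $\Delta[n]\to X$, $n\ge 0$; morphisms: maps $[n]\to[m]$ in $\Delta$ over $X$), and let $Q_X:\Delta\downarrow X\to\Delta$, $(\Delta[n]\to X)\mapsto [n]$, be the forgetful functor. For a small category $\mathcal C$ and a functor $F:\mathcal C\to\mathrm{Grp}$, let $C_*(\mathcal C,F)$ be the simplicial group whose group of $n$-simplices is the free product of the groups $F(c_0)$ over all sequences $c_0\to c_1\to\cdots\to c_n$ of composable morphisms in $\mathcal C$. Its simplicial operators compose morphisms, delete outer morphisms and insert identities, and the face $d_0$ maps the factor $F(c_0)$ of $c_0\xrightarrow{\alpha_1}c_1\to\cdots\to c_n$ to the factor $F(c_1)$ of $c_1\to\cdots\to c_n$ by $F(\alpha_1)$. The non-Abelian homology groups of $F$ are $\mathrm{colim}^{\mathcal C}_n F:=\pi_n(C_*(\mathcal C,F))$, where $\pi_n$ denotes the $n$-th homotopy group of a simplicial group (at the neutral element). For a functor $G:(\Delta\downarrow X)^{op}\to\mathrm{Grp}$, let $\mathrm{Lan}^{Q_X^{op}}G:\Delta^{op}\to\mathrm{Grp}$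 be its left Kan extension along $Q_X^{op}$, and let $H_n(X,G):=\mathrm{colim}^{\Delta^{op}}_n\,\mathrm{Lan}^{Q_X^{op}}G$ be the non-Abelian Gabriel–Zisman homology of $X$ with coefficients in $G$. Then for every $n\ge 0$ there are isomorphisms of groups $$\mathrm{colim}^{(\Delta\downarrow X)^{op}}_n G\;\cong\; H_n(X,G)\;\cong\;\pi_n\bigl(\mathrm{Lan}^{Q_X^{op}}G\bigr),$$ natural in $G\in\mathrm{Grp}^{(\Delta\downarrow X)^{op}}$. -/

import Mathlib

open CategoryTheory CategoryTheory.Limits Opposite Simplicial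

universe w v u

namespace GroupDiagram

/-! ### Small colimits of groups

These are needed so that left Kan extensions of group diagrams exist. -/

section Colimits

variable {J : Type u} [Category.{v} J] (F : J ⥤ GrpCat.{u})

/-- The relations identifying `x ∈ F i` with `F f x ∈ F j`, for `f : i ⟶ j`, in the free product
of the groups `F j`. -/
def colimitRel : Set (Monoid.CoprodI fun j : J => F.obj j) :=
  {r | ∃ (i j : J) (f : i ⟶ j) (x : F.obj i),
    r = Monoid.CoprodI.of (M := fun j : J => F.obj j) (F.map f x) *
      (Monoid.CoprodI.of (M := fun j : J => F.obj j) x)⁻¹}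

/-- The colimit cocone: the quotient of the free product by the relations above. -/
def colimitCocone : Cocone F where
  pt := GrpCat.of ((Monoid.CoprodI fun j : J => F.obj j) ⧸ Subgroup.normalClosure (colimitRel F))
  ι :=
    { app := fun j => GrpCat.ofHom (
        (QuotientGroup.mk' _).comp (Monoid.CoprodI.of (M := fun j : J => F.obj j) (i := j)))
      naturality := fun i j f => by
        ext x
        refine (QuotientGroup.eq_iff_div_mem.mpr ?_)
        rw [div_eq_mul_inv]
        exact Subgroup.subset_normalClosure ⟨i, j, f, x, rfl⟩ }

/-- The cocone above is a colimit. -/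
def colimitCoconeIsColimit : IsColimit (colimitCocone F) where
  desc s := GrpCat.ofHom (QuotientGroup.lift (Subgroup.normalClosure (colimitRel F))
    (Monoid.CoprodI.lift fun j => (s.ι.app j).hom) (by
    refine Subgroup.normalClosure_le_normal ?_
    rintro _ ⟨i, j, f, x, rfl⟩
    have h : (s.ι.app j).hom (F.map f x) = (s.ι.app i).hom x := ConcreteCategory.congr_hom (s.w f) x
    simp [MonoidHom.mem_ker, h]))
  fac s j := by
    ext x
    exact Monoid.CoprodI.lift_of (M := fun j : J => F.obj j) (N := s.pt) (fun j => (s.ι.app j).hom) x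
  uniq s m hm := by
    ext1
    refine QuotientGroup.monoidHom_ext _ (Monoid.CoprodI.ext_hom (M := fun j : J => F.obj j) _ _ fun j => ?_)
    ext x
    refine (ConcreteCategory.congr_hom (hm j) x).trans ?_
    exact (Monoid.CoprodI.lift_of (M := fun j : J => F.obj j) (N := s.pt) (fun j => (s.ι.app j).hom) x).symm

instance hasColimitsOfShape_grp : HasColimitsOfShape J GrpCat.{u} where
  has_colimit F := ⟨⟨⟨colimitCocone F, colimitCoconeIsColimit F⟩⟩⟩

end Colimits

/-! ### Homotopy groups of a simplicial group -/

section HomotopyGroups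

variable (G : SimplicialObject GrpCat.{u})

/-- The subgroup of those `x ∈ G_n` all of whose faces are trivial
(no condition is imposed if `n = 0`). -/
def cycles (n : ℕ) : Subgroup (G _⦋n⦌) :=
  match n with
  | 0 => ⊤
  | _ + 1 => ⨅ i, (G.δ i).hom.ker

/-- The subgroup of those `x ∈ G_{n+1}` whose faces `d_i x`, `i ≠ 0`, are trivial: this is the
term of degree `n + 1` of the Moore complex of `G`. -/
def moore (n : ℕ) : Subgroup (G _⦋n + 1⦌) :=
  ⨅ i : Fin (n + 1), (G.δ i.succ).hom.ker

/-- The image of the Moore differential `d_0 : N_{n+1} → N_n`. -/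
def boundaries (n : ℕ) : Subgroup (G _⦋n⦌) :=
  (moore G n).map (G.δ 0).hom

instance boundaries_normal (n : ℕ) : (boundaries G n).Normal where
  conj_mem := by
    rintro _ ⟨z, hz, rfl⟩ g
    refine ⟨G.σ 0 g * z * (G.σ 0 g)⁻¹, ?_, ?_⟩
    · simp only [moore, SetLike.mem_coe, Subgroup.mem_iInf, MonoidHom.mem_ker] at hz ⊢
      intro i
      rw [map_mul, map_mul, hz i, mul_one, map_inv, mul_inv_cancel]
    · have h : (G.δ 0).hom (G.σ 0 g) = g :=
        ConcreteCategory.congr_hom (G.δ_comp_σ_self (i := (0 : Fin (n + 1)))) g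
      rw [map_mul, map_mul, map_inv, h]

/-- The homotopy group `π_n(G)` of a simplicial group at the neutral element, as the `n`-th
homology group of its Moore complex: `n`-simplices with trivial boundary modulo those of the form
`d_0 z` with `d_i z = 1` for `i > 0`. For simplices `x`, `y` with trivial boundary, the classes of
`x` and `y` agree iff there is a homotopy `z` with `d_0 z = x`, `d_1 z = y`
and `d_i z = 1` for `i > 1`. -/
abbrev homotopyGroup (n : ℕ) : Type u :=
  cycles G n ⧸ (boundaries G n).subgroupOf (cycles G n)

variable {G} {H : SimplicialObject GrpCat.{u}} (φ : G ⟶ H)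

lemma app_mem_cycles {n : ℕ} {x : G _⦋n⦌} (hx : x ∈ cycles G n) :
    φ.app (op ⦋n⦌) x ∈ cycles H n := by
  cases n with
  | zero => exact Subgroup.mem_top _
  | succ n =>
    simp only [cycles, Subgroup.mem_iInf, MonoidHom.mem_ker] at hx ⊢
    intro i
    have h : (H.δ i).hom (φ.app (op ⦋n + 1⦌) x) = φ.app (op ⦋n⦌) ((G.δ i).hom x) :=
      (ConcreteCategory.congr_hom (φ.naturality (SimplexCategory.δ i).op) x).symm
    rw [h, hx i, map_one]

lemma app_mem_boundaries {n : ℕ} {x : G _⦋n⦌} (hx : x ∈ boundaries G n) :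
    φ.app (op ⦋n⦌) x ∈ boundaries H n := by
  obtain ⟨z, hz, rfl⟩ := hx
  have nat (i : Fin (n + 2)) :
      (H.δ i).hom (φ.app (op ⦋n + 1⦌) z) = φ.app (op ⦋n⦌) ((G.δ i).hom z) :=
    (ConcreteCategory.congr_hom (φ.naturality (SimplexCategory.δ i).op) z).symm
  refine ⟨φ.app (op ⦋n + 1⦌) z, ?_, nat 0⟩
  simp only [moore, SetLike.mem_coe, Subgroup.mem_iInf, MonoidHom.mem_ker] at hz ⊢
  intro i
  rw [nat, hz i, map_one]

/-- The map on subgroups of cycles induced by a morphism of simplicial groups. -/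
def cyclesMap (n : ℕ) : cycles G n →* cycles H n :=
  ((φ.app (op ⦋n⦌)).hom.comp (cycles G n).subtype).codRestrict (cycles H n)
    fun x => app_mem_cycles φ x.2

/-- The map on homotopy groups induced by a morphism of simplicial groups. -/
def homotopyGroupMap (n : ℕ) : homotopyGroup G n →* homotopyGroup H n :=
  QuotientGroup.map _ _ (cyclesMap φ n) fun _ hx => app_mem_boundaries φ hx

/-- The functor `π_n` from simplicial groups to groups. -/
def piFunctor (n : ℕ) : SimplicialObject GrpCat.{u} ⥤ GrpCat.{u} where
  obj G := GrpCat.of (homotopyGroup G n)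
  map φ := GrpCat.ofHom (homotopyGroupMap φ n)
  map_id G := by
    ext1
    exact QuotientGroup.monoidHom_ext _ (MonoidHom.ext fun _ => rfl)
  map_comp φ ψ := by
    ext1
    exact QuotientGroup.monoidHom_ext _ (MonoidHom.ext fun _ => rfl)

end HomotopyGroups

/-! ### Non-Abelian homology of group diagrams -/

section Homology

variable {C : Type w} [Category.{v} C]

/-- The group of `m`-simplices of the simplicial replacement: the free product of the groups
`F(c_0)` over all sequences `c_0 → ⋯ → c_m` of `m` composable morphisms in `C`. -/
abbrev Replacement (F : C ⥤ GrpCat.{u}) (m : ℕ) : Type (max w v u) :=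
  Monoid.CoprodI fun σ : ComposableArrows C m => F.obj (σ.obj 0)

/-- The inclusion of the free factor indexed by `σ`. -/
abbrev incl (F : C ⥤ GrpCat.{u}) {m : ℕ} (σ : ComposableArrows C m) :
    F.obj (σ.obj 0) →* Replacement F m :=
  Monoid.CoprodI.of (M := fun σ : ComposableArrows C m => F.obj (σ.obj 0)) (i := σ)

/-- The simplicial operator `C_n(C, F) → C_m(C, F)` induced by `f : [m] → [n]`: on the factor
`F(c_0)` indexed by `σ = (c_0 → ⋯ → c_n)` it is `F(c_0 → c_{f(0)})`, followed by the inclusion of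
the factor indexed by `σ ∘ f = (c_{f(0)} → ⋯ → c_{f(m)})`. -/
def replacementMap (F : C ⥤ GrpCat.{u}) {m n : SimplexCategory} (f : m ⟶ n) :
    Replacement F n.len →* Replacement F m.len :=
  Monoid.CoprodI.lift fun σ =>
    (incl F (σ.whiskerLeft f.toOrderHom.monotone.functor)).comp
      (F.map (σ.map (homOfLE (Fin.zero_le (f.toOrderHom 0))))).hom

lemma replacementMap_incl (F : C ⥤ GrpCat.{u}) {m n : SimplexCategory} (f : m ⟶ n)
    (σ : ComposableArrows C n.len) (x : F.obj (σ.obj 0)) :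
    replacementMap F f (incl F σ x) =
      incl F (σ.whiskerLeft f.toOrderHom.monotone.functor)
        (F.map (σ.map (homOfLE (Fin.zero_le (f.toOrderHom 0)))) x) :=
  Monoid.CoprodI.lift_of _ _

lemma replacement_hom_ext {F : C ⥤ GrpCat.{u}} {m : ℕ} {H : Type*} [Monoid H]
    {φ ψ : Replacement F m →* H} (h : ∀ σ x, φ (incl F σ x) = ψ (incl F σ x)) : φ = ψ :=
  Monoid.CoprodI.ext_hom _ _ fun σ => MonoidHom.ext (h σ)

/-- The simplicial replacement `C_*(C, F)` of a group diagram `F : C ⥤ Grp`, as a simplicial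
group. -/
def simplicialReplacementObj (F : C ⥤ GrpCat.{u}) : SimplicialObject GrpCat.{max w v u} where
  obj n := GrpCat.of (Replacement F n.unop.len)
  map f := GrpCat.ofHom (replacementMap F f.unop)
  map_id n := by
    ext1
    refine replacement_hom_ext fun σ x => (replacementMap_incl F _ σ x).trans ?_
    have h : F.map (σ.map (𝟙 (0 : Fin (n.unop.len + 1)))) x = x := by simp
    exact congrArg (incl F σ) h
  map_comp f g := by
    ext1
    refine replacement_hom_ext fun σ x => (replacementMap_incl F _ σ x).trans ?_
    refine Eq.trans ?_ (congrArg (replacementMap F g.unop)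
      (replacementMap_incl F f.unop σ x)).symm
    refine Eq.trans ?_ (replacementMap_incl F g.unop _ _).symm
    refine congrArg (incl F (σ.whiskerLeft (f ≫ g).unop.toOrderHom.monotone.functor)) ?_
    refine Eq.trans ?_ (ConcreteCategory.comp_apply _ _ _)
    refine ConcreteCategory.congr_hom ?_ x
    refine Eq.trans ?_ (F.map_comp _ _)
    exact congrArg F.map (σ.map_comp _ _)

/-- The map `C_m(C, F) → C_m(C, F')` induced by a natural transformation `F ⟶ F'`, acting
factorwise. -/
def replacementNat {F F' : C ⥤ GrpCat.{u}} (η : F ⟶ F') (m : ℕ) :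
    Replacement F m →* Replacement F' m :=
  Monoid.CoprodI.lift fun σ => (incl F' σ).comp (η.app (σ.obj 0)).hom

lemma replacementNat_incl {F F' : C ⥤ GrpCat.{u}} (η : F ⟶ F') {m : ℕ}
    (σ : ComposableArrows C m) (x : F.obj (σ.obj 0)) :
    replacementNat η m (incl F σ x) = incl F' σ (η.app (σ.obj 0) x) :=
  Monoid.CoprodI.lift_of _ _

/-- The simplicial replacement as a functor of the group diagram. -/
def simplicialReplacement (C : Type w) [Category.{v} C] :
    (C ⥤ GrpCat.{u}) ⥤ SimplicialObject GrpCat.{max w v u} where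
  obj F := simplicialReplacementObj F
  map {F F'} η :=
    { app := fun n => GrpCat.ofHom (replacementNat η n.unop.len)
      naturality := fun m n f => by
        ext1
        refine replacement_hom_ext fun σ x => ?_
        refine (congrArg (replacementNat η n.unop.len)
          (replacementMap_incl F f.unop σ x)).trans ?_
        refine (replacementNat_incl η _ _).trans ?_
        refine Eq.trans ?_ (congrArg (replacementMap F' f.unop)
          (replacementNat_incl η σ x)).symm
        refine Eq.trans ?_ (replacementMap_incl F' f.unop σ _).symm
        exact congrArg (incl F' (σ.whiskerLeft f.unop.toOrderHom.monotone.functor))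
          (ConcreteCategory.congr_hom (η.naturality _) x) }
  map_id F := by
    apply NatTrans.ext
    funext n
    ext1
    exact replacement_hom_ext fun σ x => replacementNat_incl _ σ x
  map_comp η θ := by
    apply NatTrans.ext
    funext n
    ext1
    refine replacement_hom_ext fun σ x => (replacementNat_incl _ σ x).trans ?_
    refine Eq.trans ?_ (congrArg (replacementNat θ n.unop.len)
      (replacementNat_incl η σ x)).symm
    exact (replacementNat_incl θ σ _).symm

/-- The non-Abelian homology functor `colim_n^C : Grp^C ⥤ Grp`, `F ↦ π_n(C_*(C, F))`. -/
def colimN (C : Type w) [Category.{v} C] (n : ℕ) : (C ⥤ GrpCat.{u}) ⥤ GrpCat.{max w v u} :=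
  simplicialReplacement C ⋙ piFunctor n

end Homology

/-! ### Non-Abelian Gabriel–Zisman homology of simplicial sets -/

section GabrielZisman

variable (X : SSet.{u})

/-- The Yoneda embedding `[n] ↦ Δ[n]` of `Δ` into simplicial sets
(with values lifted to the universe of `X`). -/
abbrev simplexYoneda : SimplexCategory ⥤ SSet.{u} := uliftYoneda.{u}

/-- The category `Δ ↓ X` of simplices of `X`: objects are the morphisms `Δ[n] ⟶ X`. -/
abbrev SimplexOver : Type u := CostructuredArrow simplexYoneda.{u} X

/-- The forgetful functor `Q_X : Δ ↓ X ⥤ Δ`, `(Δ[n] ⟶ X) ↦ [n]`. -/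
abbrev forgetSimplex : SimplexOver X ⥤ SimplexCategory :=
  CostructuredArrow.proj simplexYoneda.{u} X

/-- The simplicial group `Lan^{Q_X^op} G` associated with a group diagram `G` on `(Δ ↓ X)^op`,
as a functor of `G`. -/
noncomputable def lanSimplicialGroup :
    ((SimplexOver X)ᵒᵖ ⥤ GrpCat.{u}) ⥤ SimplicialObject GrpCat.{u} :=
  (forgetSimplex X).op.lan

/-- The non-Abelian homology `H_n(X, G) = colim_n^{Δ^op} Lan^{Q_X^op} G` of the simplicial
set `X` with coefficients in the group diagram `G`, as a functor of `G`. -/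
noncomputable def gabrielZismanHomology (n : ℕ) :
    ((SimplexOver X)ᵒᵖ ⥤ GrpCat.{u}) ⥤ GrpCat.{u} :=
  lanSimplicialGroup X ⋙ colimN SimplexCategoryᵒᵖ n

end GabrielZisman

end GroupDiagram

/-! The forgetful functor Q_X lifts arrows uniquely: a map [m] → [k] and a simplex Δ[k] → X
determine an arrow of Δ↓X. Hence Lan G is, in degree k, the free product of the groups G(x) over all
x : Δ[k] → X (`kanIsoLan`). A chain in Δ^op together with a simplex of X over its first object is
the same as a chain in (Δ↓X)^op, so the simplicial replacements of G and of Lan G are isomorphic as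
simplicial groups (`flattenIso`). This gives the first isomorphism.

The second holds for every simplicial group A in place of Lan G (`colimNSimplexIso`). Consider the
bisimplicial group whose (p,q)-simplices form the free product of A(c_0) over the chains c_0 → ⋯ →
c_p → [q] in Δ^op. For fixed q it resolves A_q: appending [q] to the chain is an extra degeneracy
(`isResolution_bar`). For fixed p the last arrow runs over the q-simplices of Δ[c_p], and the
contraction of Δ[c_p] to its vertex 0 permutes free factors into free factors, so it induces
homomorphisms; the column therefore resolves C_p(Δ^op, A) (`isResolution_column`).

It remains to compare two simplicial groups resolved by the same bisimplicial group. The groups are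
not abelian, so there is no total complex. Instead, normalizing in both directions gives a double
complex with exact augmented rows and columns, whose squares commute without signs, and staircases
in it relate cycles of A to cycles of C. All differentials are homomorphisms, so this relation is a
subgroup of the product; exactness makes it the graph of an isomorphism on homotopy groups
(`isQuotientGraph`). A morphism of bisimplicial groups carries staircases to staircases, whence
naturality. -/

namespace GroupDiagram

/-! ### Isomorphisms of quotient groups defined by relations -/

section RelationIso

variable {Z₁ Z₂ : Type*} [Group Z₁] [Group Z₂] {B₁ : Subgroup Z₁} {B₂ : Subgroup Z₂}
  [B₁.Normal] [B₂.Normal]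

/-- A subgroup of `Z₁ × Z₂` which is the graph of an isomorphism `Z₁ ⧸ B₁ ≃* Z₂ ⧸ B₂`. -/
structure IsQuotientGraph (B₁ : Subgroup Z₁) (B₂ : Subgroup Z₂) (R : Subgroup (Z₁ × Z₂)) :
    Prop where
  total (a : Z₁) : ∃ c, (a, c) ∈ R
  surj (c : Z₂) : ∃ a, (a, c) ∈ R
  mem_iff {a : Z₁} {c : Z₂} (h : (a, c) ∈ R) : a ∈ B₁ ↔ c ∈ B₂

namespace IsQuotientGraph

variable {R : Subgroup (Z₁ × Z₂)} (hR : IsQuotientGraph B₁ B₂ R)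

-- Since `R` is a subgroup, comparing two pairs reduces to `mem_iff` for the single pair (a⁻¹a',
-- c⁻¹c').
omit [B₁.Normal] [B₂.Normal] in
include hR in
lemma mk_eq_mk {a a' : Z₁} {c c' : Z₂} (h : (a, c) ∈ R) (h' : (a', c') ∈ R)
    (e : (a : Z₁ ⧸ B₁) = a') : (c : Z₂ ⧸ B₂) = c' := by
  rw [QuotientGroup.eq] at e ⊢
  exact (hR.mem_iff (R.mul_mem (R.inv_mem h) h')).1 e

/-- The homomorphism with graph `R`. -/
noncomputable def hom : Z₁ ⧸ B₁ →* Z₂ ⧸ B₂ :=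
  QuotientGroup.lift B₁
    (MonoidHom.mk' (fun a => ((hR.total a).choose : Z₂ ⧸ B₂)) fun a b => by
      rw [← QuotientGroup.mk_mul]
      exact hR.mk_eq_mk (hR.total (a * b)).choose_spec
        (R.mul_mem (hR.total a).choose_spec (hR.total b).choose_spec) rfl)
    fun a ha => (QuotientGroup.eq_one_iff _).2 ((hR.mem_iff (hR.total a).choose_spec).1 ha)

lemma hom_mk {a : Z₁} {c : Z₂} (h : (a, c) ∈ R) : hR.hom (a : Z₁ ⧸ B₁) = c :=
  hR.mk_eq_mk (hR.total a).choose_spec h rfl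

lemma hom_bijective : Function.Bijective hR.hom := by
  constructor
  · rw [injective_iff_map_eq_one]
    intro a ha
    induction a using QuotientGroup.induction_on with | H a =>
    obtain ⟨c, hc⟩ := hR.total a
    rw [hR.hom_mk hc, QuotientGroup.eq_one_iff] at ha
    exact (QuotientGroup.eq_one_iff _).2 ((hR.mem_iff hc).2 ha)
  · intro c
    induction c using QuotientGroup.induction_on with | H c =>
    obtain ⟨a, ha⟩ := hR.surj c
    exact ⟨a, hR.hom_mk ha⟩

/-- The isomorphism with graph `R`. -/
noncomputable def equiv : Z₁ ⧸ B₁ ≃* Z₂ ⧸ B₂ :=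
  MulEquiv.ofBijective hR.hom hR.hom_bijective

lemma equiv_mk {a : Z₁} {c : Z₂} (h : (a, c) ∈ R) : hR.equiv (a : Z₁ ⧸ B₁) = c :=
  hR.hom_mk h

end IsQuotientGraph

end RelationIso

/-! ### Double complexes of groups with exact rows and columns -/

/-- A first quadrant double complex of (not necessarily commutative) groups `N p q`, whose rows
`N 0 q ← N 1 q ← ⋯` are resolutions of the terms of a chain complex `A` and whose columns
`N p 0 ← N p 1 ← ⋯` are resolutions of the terms of a chain complex `C`. -/
structure DoubleResolution (N : ℕ → ℕ → Type u) [∀ p q, Group (N p q)]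
    (A C : ℕ → Type u) [∀ n, Group (A n)] [∀ n, Group (C n)] where
  /-- the horizontal differential -/
  dh (p q : ℕ) : N (p + 1) q →* N p q
  /-- the vertical differential -/
  dv (p q : ℕ) : N p (q + 1) →* N p q
  /-- the differential of `A` -/
  dA (q : ℕ) : A (q + 1) →* A q
  /-- the differential of `C` -/
  dC (p : ℕ) : C (p + 1) →* C p
  /-- the augmentation of the rows -/
  augA (q : ℕ) : N 0 q →* A q
  /-- the augmentation of the columns -/
  augC (p : ℕ) : N p 0 →* C p
  dh_dv (p q : ℕ) (x : N (p + 1) (q + 1)) : dh p q (dv (p + 1) q x) = dv p q (dh p (q + 1) x)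
  dh_dh (p q : ℕ) (x : N (p + 2) q) : dh p q (dh (p + 1) q x) = 1
  dv_dv (p q : ℕ) (x : N p (q + 2)) : dv p q (dv p (q + 1) x) = 1
  augA_dv (q : ℕ) (x : N 0 (q + 1)) : augA q (dv 0 q x) = dA q (augA (q + 1) x)
  augC_dh (p : ℕ) (x : N (p + 1) 0) : augC p (dh p 0 x) = dC p (augC (p + 1) x)
  augA_dh (q : ℕ) (x : N 1 q) : augA q (dh 0 q x) = 1
  augC_dv (p : ℕ) (x : N p 1) : augC p (dv p 0 x) = 1
  augA_surj (q : ℕ) (a : A q) : ∃ x, augA q x = a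
  augC_surj (p : ℕ) (c : C p) : ∃ x, augC p x = c
  augA_exact (q : ℕ) (x : N 0 q) (hx : augA q x = 1) : ∃ y, dh 0 q y = x
  augC_exact (p : ℕ) (x : N p 0) (hx : augC p x = 1) : ∃ y, dv p 0 y = x
  dh_exact (p q : ℕ) (x : N (p + 1) q) (hx : dh p q x = 1) : ∃ y, dh (p + 1) q y = x
  dv_exact (p q : ℕ) (x : N p (q + 1)) (hx : dv p q x = 1) : ∃ y, dv p (q + 1) y = x

namespace DoubleResolution

variable {N : ℕ → ℕ → Type u} [∀ p q, Group (N p q)]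
    {A C : ℕ → Type u} [∀ n, Group (A n)] [∀ n, Group (C n)] (D : DoubleResolution N A C)

/-- `D.Stair a x` says that `x : N p q` is the end of a sequence of elements
`x₀ : N 0 n`, `x₁ : N 1 (n - 1)`, …, `x_p = x` such that `augA x₀ = a` and
`dh x_{i + 1} = dv x_i`. -/
inductive Stair {n : ℕ} (a : A n) : {p q : ℕ} → N p q → Prop
| base (x : N 0 n) (hx : D.augA n x = a) : Stair a x
| step {p q : ℕ} (x : N p (q + 1)) (y : N (p + 1) q) (hx : Stair a x)
      (hxy : D.dh p q y = D.dv p q x) : Stair a y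

/-- The condition on an element of degree `n` of a chain complex of groups to be a cycle. -/
def IsCycle {A : ℕ → Type u} [∀ n, Group (A n)] (d : ∀ q, A (q + 1) →* A q) :
    {n : ℕ} → A n → Prop
| 0, _ => True
| n + 1, a => d n a = 1

variable {D} {n : ℕ} {a b : A n}

lemma Stair.one : ∀ p q : ℕ, p + q = n → D.Stair (1 : A n) (1 : N p q)
| 0, q, h => by
    obtain rfl : q = n := by omega
    exact .base 1 (map_one _)
| p + 1, q, h => .step 1 1 (Stair.one p (q + 1) (by omega)) (by simp)

lemma Stair.mul {p q : ℕ} {x y : N p q} (hx : D.Stair a x) (hy : D.Stair b y) :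
    D.Stair (a * b) (x * y) := by
  induction hx with
  | base x hx =>
    cases hy with
    | base y hy => exact .base _ (by rw [map_mul, hx, hy])
  | step x₀ x hx h ih =>
    cases hy with
    | step y₀ y hy h' => exact .step _ _ (ih hy) (by rw [map_mul, map_mul, h, h'])

lemma Stair.inv {p q : ℕ} {x : N p q} (hx : D.Stair a x) : D.Stair a⁻¹ x⁻¹ := by
  induction hx with
  | base x hx => exact .base _ (by rw [map_inv, hx])
  | step x₀ x hx h ih => exact .step _ _ ih (by rw [map_inv, map_inv, h])

/-- Row exactness applies because `dv x` is killed by the next horizontal map: at the start of a row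
since `a` is a cycle, later since `dh (dv x) = dv (dh x)` is a double vertical differential. -/
lemma Stair.exists_step {p q : ℕ} {x : N p (q + 1)} (hx : D.Stair a x)
    (ha : IsCycle D.dA a) : ∃ y : N (p + 1) q, D.Stair a y := by
  suffices h : ∃ y, D.dh p q y = D.dv p q x by
    obtain ⟨y, hy⟩ := h
    exact ⟨y, .step x y hx hy⟩
  cases hx with
  | base x hx => exact D.augA_exact _ _ (by rw [D.augA_dv, hx]; exact ha)
  | step x₀ x hx h => exact D.dh_exact _ _ _ (by rw [D.dh_dv, h, D.dv_dv])

lemma exists_stair (ha : IsCycle D.dA a) :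
    ∀ p q : ℕ, p + q = n → ∃ x : N p q, D.Stair a x
| 0, q, h => by
    obtain rfl : q = n := by omega
    obtain ⟨x, hx⟩ := D.augA_surj q a
    exact ⟨x, .base x hx⟩
| p + 1, q, h => by
    obtain ⟨x, hx⟩ := exists_stair ha p (q + 1) (by omega)
    exact hx.exists_step ha

lemma Stair.isCycle_augC {x : N n 0} (hx : D.Stair a x) : IsCycle D.dC (D.augC n x) := by
  cases hx with
  | base x hx => trivial
  | step x₀ x hx h =>
    change D.dC _ _ = 1
    rw [← D.augC_dh, h, D.augC_dv]

/-- The first step of a staircase already forces `a` to be a cycle: there `dA a = augA (dv x₀) =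
augA (dh x₁) = 1`. A staircase without steps says nothing about `a`. -/
lemma Stair.eq_zero_or_isCycle {p q : ℕ} {x : N p q} (hx : D.Stair a x) :
    p = 0 ∨ IsCycle D.dA a := by
  induction hx with
  | base x hx => exact Or.inl rfl
  | @step p q x y hx h ih =>
    refine Or.inr (ih.elim (fun hp => ?_) id)
    subst hp
    cases hx with
    | base x hx =>
      change D.dA _ _ = 1
      rw [← hx, ← D.augA_dv, ← h, D.augA_dh]

lemma Stair.isCycle {x : N n 0} (hx : D.Stair a x) : IsCycle D.dA a := by
  refine hx.eq_zero_or_isCycle.elim (fun h => ?_) id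
  subst h
  trivial

/-- The staircase is built backwards from its end. The hypothesis asks that `dh x` lie in the image
of `dv`, which is vacuous for `p = 0`; the `HEq` makes it expressible for a variable `p`. It passes
to the preceding element `y`, as `dv (dh y) = dh (dh x) = 1` and columns are exact. -/
lemma exists_stair_to (D : DoubleResolution N A C) (n : ℕ) : ∀ (p q : ℕ) (x : N p q), p + q = n →
    (∀ (p' : ℕ) (x' : N (p' + 1) q), p = p' + 1 → HEq x x' → ∃ y, D.dv p' q y = D.dh p' q x') →
    ∃ a : A n, D.Stair a x
| 0, q, x, h, _ => by
    obtain rfl : q = n := by omega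
    exact ⟨_, .base x rfl⟩
| p + 1, q, x, h, hx => by
    obtain ⟨y, hy⟩ := hx p x rfl HEq.rfl
    obtain ⟨a, ha⟩ := exists_stair_to D n p (q + 1) y (by omega) (by
      rintro p' y' rfl hyy'
      obtain rfl := eq_of_heq hyy'
      exact D.dv_exact _ _ _ (by rw [← D.dh_dv, hy, D.dh_dh]))
    exact ⟨a, .step y x ha hy.symm⟩

lemma exists_stair_of_isCycle (D : DoubleResolution N A C) (n : ℕ) (c : C n)
    (hc : IsCycle D.dC c) : ∃ (a : A n) (x : N n 0), D.Stair a x ∧ D.augC n x = c := by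
  obtain ⟨x, rfl⟩ := D.augC_surj n c
  obtain ⟨a, ha⟩ := exists_stair_to D n n 0 x rfl (by
    rintro p' x' rfl h
    obtain rfl := eq_of_heq h
    exact D.augC_exact _ _ ((D.augC_dh _ _).trans hc))
  exact ⟨a, x, ha, rfl⟩

/-- Along the staircase the `dh`-part `u` of one element supplies the `dv`-part of the next. The
order of the two factors matters, as the images need not be normal: here the `dv` factor is
cancelled on the left, in the converse the `dh` factor on the right. -/
lemma Stair.exists_of_boundary {p q : ℕ} {x : N p q} (hx : D.Stair a x)
    (ha : ∃ b, D.dA n b = a) : ∃ w u, x = D.dv p q w * D.dh p q u := by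
  induction hx with
  | base x hx =>
    obtain ⟨b, rfl⟩ := ha
    obtain ⟨w, rfl⟩ := D.augA_surj _ b
    obtain ⟨u, hu⟩ := D.augA_exact n ((D.dv 0 n w)⁻¹ * x) (by
      rw [map_mul, map_inv, hx, D.augA_dv, inv_mul_cancel])
    exact ⟨w, u, by rw [hu, mul_inv_cancel_left]⟩
  | @step p q x y hx h ih =>
    obtain ⟨w, u, rfl⟩ := ih
    obtain ⟨t, ht⟩ := D.dh_exact p q ((D.dv (p + 1) q u)⁻¹ * y) (by
      rw [map_mul, map_inv, h, map_mul, D.dh_dv, D.dv_dv, one_mul, inv_mul_cancel])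
    exact ⟨u, t, by rw [ht, mul_inv_cancel_left]⟩

lemma Stair.boundary_of_exists {p q : ℕ} {x : N p q} (hx : D.Stair a x)
    (h : ∃ w u, x = D.dv p q w * D.dh p q u) : ∃ b, D.dA n b = a := by
  induction hx with
  | base x hx =>
    obtain ⟨w, u, rfl⟩ := h
    exact ⟨D.augA _ w, by rw [← hx, map_mul, D.augA_dv, D.augA_dh, mul_one]⟩
  | @step p q x y hx hxy ih =>
    obtain ⟨w, u, rfl⟩ := h
    refine ih ?_
    obtain ⟨t, ht⟩ := D.dv_exact p q (x * (D.dh p (q + 1) w)⁻¹) (by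
      rw [map_mul, map_inv, ← hxy, map_mul, D.dh_dv, D.dh_dh, mul_one, mul_inv_cancel])
    exact ⟨t, w, by rw [ht, inv_mul_cancel_right]⟩

lemma Stair.boundary_iff {x : N n 0} (hx : D.Stair a x) :
    (∃ b, D.dA n b = a) ↔ ∃ e, D.dC n e = D.augC n x := by
  constructor
  · intro h
    obtain ⟨w, u, rfl⟩ := hx.exists_of_boundary h
    exact ⟨D.augC _ u, by rw [map_mul, D.augC_dh, D.augC_dv, one_mul]⟩
  · rintro ⟨e, he⟩
    refine hx.boundary_of_exists ?_
    obtain ⟨u, rfl⟩ := D.augC_surj _ e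
    obtain ⟨w, hw⟩ := D.augC_exact n (x * (D.dh n 0 u)⁻¹) (by
      rw [map_mul, map_inv, ← he, D.augC_dh, mul_inv_cancel])
    exact ⟨w, u, by rw [hw, inv_mul_cancel_right]⟩

lemma Stair.map {N' : ℕ → ℕ → Type u} [∀ p q, Group (N' p q)]
    {A' C' : ℕ → Type u} [∀ n, Group (A' n)] [∀ n, Group (C' n)] {D' : DoubleResolution N' A' C'}
    (f : ∀ p q, N p q → N' p q) (g : ∀ n, A n → A' n)
    (hh : ∀ p q x, f p q (D.dh p q x) = D'.dh p q (f (p + 1) q x))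
    (hv : ∀ p q x, f p q (D.dv p q x) = D'.dv p q (f p (q + 1) x))
    (haugA : ∀ q x, g q (D.augA q x) = D'.augA q (f 0 q x))
    {p q : ℕ} {x : N p q} (hx : D.Stair a x) : D'.Stair (g n a) (f p q x) := by
  induction hx with
  | base x hx => exact .base _ (by rw [← haugA, hx])
  | step x y hx h ih => exact .step _ _ ih (by rw [← hh, ← hv, h])

end DoubleResolution

end GroupDiagram
namespace GroupDiagram

/-! ### Normalization in simplicial groups -/

section Moore

variable (G : SimplicialObject GrpCat.{u})

/-- The term of degree `n` of the Moore complex of a simplicial group. -/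
def mooreTerm (n : ℕ) : Subgroup (G _⦋n⦌) :=
  match n with
  | 0 => ⊤
  | n + 1 => moore G n

variable {G}

lemma mem_moore_iff {n : ℕ} {x : G _⦋n + 1⦌} :
    x ∈ moore G n ↔ ∀ i : Fin (n + 1), G.δ i.succ x = 1 := by
  simp only [moore, Subgroup.mem_iInf, MonoidHom.mem_ker]

lemma mem_cycles_succ_iff {n : ℕ} {x : G _⦋n + 1⦌} :
    x ∈ cycles G (n + 1) ↔ ∀ i, G.δ i x = 1 := by
  simp only [cycles, Subgroup.mem_iInf, MonoidHom.mem_ker]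

lemma mem_cycles_succ_iff_moore {n : ℕ} {x : G _⦋n + 1⦌} :
    x ∈ cycles G (n + 1) ↔ x ∈ moore G n ∧ G.δ 0 x = 1 := by
  rw [mem_cycles_succ_iff, mem_moore_iff, Fin.forall_fin_succ, and_comm]

lemma cycles_le_mooreTerm (n : ℕ) : cycles G n ≤ mooreTerm G n := by
  cases n with
  | zero => exact le_rfl
  | succ n => exact fun x hx => (mem_cycles_succ_iff_moore.1 hx).1

lemma app_δ {H : SimplicialObject GrpCat.{u}} (φ : G ⟶ H) {n : ℕ} (i : Fin (n + 2))
    (x : G _⦋n + 1⦌) : φ.app _ (G.δ i x) = H.δ i (φ.app _ x) :=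
  ConcreteCategory.congr_hom (φ.naturality (SimplexCategory.δ i).op) x

lemma app_σ {H : SimplicialObject GrpCat.{u}} (φ : G ⟶ H) {n : ℕ} (i : Fin (n + 1))
    (x : G _⦋n⦌) : φ.app _ (G.σ i x) = H.σ i (φ.app _ x) :=
  ConcreteCategory.congr_hom (φ.naturality (SimplexCategory.σ i).op) x

lemma app_mem_mooreTerm {H : SimplicialObject GrpCat.{u}} (φ : G ⟶ H) {n : ℕ} {x : G _⦋n⦌}
    (hx : x ∈ mooreTerm G n) : φ.app _ x ∈ mooreTerm H n := by
  cases n with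
  | zero => exact Subgroup.mem_top _
  | succ n =>
    refine mem_moore_iff.2 fun i => ?_
    rw [← app_δ, mem_moore_iff.1 hx i, map_one]

lemma δ_δ_apply {n : ℕ} {i j : Fin (n + 2)} (h : i ≤ j) (x : G _⦋n + 2⦌) :
    G.δ i (G.δ j.succ x) = G.δ j (G.δ i.castSucc x) :=
  ConcreteCategory.congr_hom (G.δ_comp_δ h) x

lemma δ_zero_mem_mooreTerm {n : ℕ} {x : G _⦋n + 1⦌} (hx : x ∈ mooreTerm G (n + 1)) :
    G.δ 0 x ∈ mooreTerm G n := by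
  cases n with
  | zero => exact Subgroup.mem_top _
  | succ n =>
    refine mem_moore_iff.2 fun i => ?_
    rw [← Fin.castSucc_zero, ← δ_δ_apply (Fin.zero_le _), mem_moore_iff.1 hx, map_one]

lemma δ_zero_δ_zero {n : ℕ} {x : G _⦋n + 2⦌} (hx : x ∈ mooreTerm G (n + 2)) :
    G.δ 0 (G.δ 0 x) = 1 := by
  have h := δ_δ_apply (i := 0) (j := 0) le_rfl x
  rw [mem_moore_iff.1 hx, map_one] at h
  exact h.symm

/-- Faces are killed one at a time, from the last down to the face 1, by dividing by a degeneracy of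
the face. The images of these corrections are trivial because the images of `y` are already
normalized. This is what keeps exactness when normalizing in the second direction. -/
lemma exists_mem_mooreTerm {ι : Type*} {H : ι → SimplicialObject GrpCat.{u}}
    (φ : ∀ i, G ⟶ H i) {n : ℕ} (y : G _⦋n⦌)
    (hy : ∀ i, (φ i).app _ y ∈ mooreTerm (H i) n) :
    ∃ z ∈ mooreTerm G n, ∀ i, (φ i).app _ z = (φ i).app _ y := by
  cases n with
  | zero => exact ⟨y, Subgroup.mem_top _, fun _ => rfl⟩
  | succ n =>
    suffices h : ∀ k ≤ n + 1, ∃ z : G _⦋n + 1⦌,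
        (∀ j : Fin (n + 1), n + 1 ≤ j.val + k → G.δ j.succ z = 1) ∧
          ∀ i, (φ i).app _ z = (φ i).app _ y by
      obtain ⟨z, hz, hz'⟩ := h (n + 1) le_rfl
      exact ⟨z, mem_moore_iff.2 fun j => hz j (by omega), hz'⟩
    intro k hk
    induction k with
    | zero => exact ⟨y, fun j hj => by omega, fun _ => rfl⟩
    | succ k ih =>
      obtain ⟨z, hz, hz'⟩ := ih (by omega)
      -- The top `k` faces are trivial so far; `r + 1` is the index of the highest remaining one.
      obtain ⟨r, hr⟩ : ∃ r : Fin (n + 1), r.val + k = n := ⟨⟨n - k, by omega⟩, by simp; omega⟩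
      refine ⟨z * (G.σ r (G.δ r.succ z))⁻¹, fun j hj => ?_, fun i => ?_⟩
      · rw [map_mul, map_inv]
        obtain rfl | hjr := eq_or_ne j r
        · have h : G.δ j.succ (G.σ j (G.δ j.succ z)) = G.δ j.succ z :=
            ConcreteCategory.congr_hom (G.δ_comp_σ_succ (i := j)) _
          rw [h, mul_inv_cancel]
        · have hlt : r < j := by
            rw [Fin.lt_def]
            have := Fin.val_ne_of_ne hjr
            omega
          rw [hz j (by rw [Fin.lt_def] at hlt; omega), one_mul, inv_eq_one]
          obtain _ | n := n
          · omega
          obtain ⟨r, rfl⟩ := Fin.exists_castSucc_eq.2 (Fin.ne_last_of_lt hlt)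
          have h : G.δ j.succ (G.σ r.castSucc (G.δ r.castSucc.succ z)) =
              G.σ r (G.δ j (G.δ r.castSucc.succ z)) :=
            ConcreteCategory.congr_hom (G.δ_comp_σ_of_gt hlt) _
          rw [h, Fin.succ_castSucc, ← δ_δ_apply (i := r.succ) (j := j) (by
            rw [Fin.le_def]; rw [Fin.lt_def] at hlt; simpa using hlt), hz j (by
            rw [Fin.lt_def] at hlt; omega), map_one, map_one]
      · have hi := mem_moore_iff.1 (hy i) r
        rw [map_mul, map_inv, app_σ, app_δ, hz', hi, map_one, inv_one, mul_one]

/-- Each such face is a degeneracy of a face of `x`, hence trivial. For `n = 0` no index is left. -/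
lemma δ_σ_apply_of_cycle {n : ℕ} {x : G _⦋n⦌} (hx : x ∈ cycles G n) (k : Fin (n + 1))
    (j : Fin (n + 2)) (h₁ : j ≠ k.castSucc) (h₂ : j ≠ k.succ) : G.δ j (G.σ k x) = 1 := by
  obtain _ | n := n
  · obtain rfl : k = 0 := Subsingleton.elim (α := Fin 1) k 0
    fin_cases j
    · exact (h₁ rfl).elim
    · exact (h₂ rfl).elim
  rw [mem_cycles_succ_iff] at hx
  obtain hlt | hlt := lt_or_gt_of_ne h₁
  · obtain ⟨j, rfl⟩ := Fin.exists_castSucc_eq.2 (Fin.ne_last_of_lt hlt)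
    obtain ⟨k, rfl⟩ := Fin.exists_succ_eq.2 (show k ≠ 0 by
      rintro rfl
      simp at hlt)
    have h : G.δ j.castSucc (G.σ k.succ x) = G.σ k (G.δ j x) :=
      ConcreteCategory.congr_hom (G.δ_comp_σ_of_le (by
        rw [Fin.le_def]; rw [Fin.lt_def] at hlt; simp at hlt ⊢; omega)) x
    rw [h, hx, map_one]
  · have hlt' : k.succ < j := lt_of_le_of_ne (Fin.castSucc_lt_iff_succ_le.1 hlt) h₂.symm
    obtain ⟨j, rfl⟩ := Fin.exists_succ_eq.2 (Fin.ne_zero_of_lt hlt)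
    rw [Fin.succ_lt_succ_iff] at hlt'
    obtain ⟨k, rfl⟩ := Fin.exists_castSucc_eq.2 (Fin.ne_last_of_lt hlt')
    have h : G.δ j.succ (G.σ k.castSucc x) = G.σ k (G.δ j x) :=
      ConcreteCategory.congr_hom (G.δ_comp_σ_of_gt hlt') x
    rw [h, hx, map_one]

/-- A cycle is a boundary if it is some face of a simplex whose other faces are trivial. -/
lemma mem_boundaries_of_face {n : ℕ} {x : G _⦋n⦌} (hx : x ∈ cycles G n) (k : Fin (n + 2)) :
    ∀ y : G _⦋n + 1⦌, G.δ k y = x → (∀ j ≠ k, G.δ j y = 1) → x ∈ boundaries G n := by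
  induction k using Fin.induction with
  | zero =>
    exact fun y hy hy' => ⟨y, mem_moore_iff.2 fun i => hy' _ (Fin.succ_ne_zero i), hy⟩
  | succ k ih =>
    intro y hy hy'
    have h₁ : G.δ k.castSucc (G.σ k x) = x :=
      ConcreteCategory.congr_hom (G.δ_comp_σ_self (i := k)) x
    have h₂ : G.δ k.succ (G.σ k x) = x :=
      ConcreteCategory.congr_hom (G.δ_comp_σ_succ (i := k)) x
    -- The simplex `σ k x` has both faces `k` and `k + 1` equal to `x`. Multiplying it by `y⁻¹`
    -- cancels the face `k + 1` and leaves `x` at `k`, so the nontrivial face moves down by one.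
    refine ih (G.σ k x * y⁻¹) ?_ fun j hj => ?_
    · rw [map_mul, map_inv, h₁, hy' _ (Fin.castSucc_lt_succ).ne, inv_one, mul_one]
    · rw [map_mul, map_inv]
      obtain rfl | hj' := eq_or_ne j k.succ
      · rw [h₂, hy, mul_inv_cancel]
      · rw [hy' _ hj', δ_σ_apply_of_cycle hx k j hj hj', inv_one, mul_one]

end Moore

/-! ### Bisimplicial groups with contractible rows and columns -/

/-- An augmented simplicial group without homotopy. -/
structure IsResolution (G : SimplicialObject GrpCat.{u}) {Y : GrpCat.{u}} (aug : G _⦋0⦌ ⟶ Y) :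
    Prop where
  w (x : G _⦋1⦌) : aug (G.δ 0 x) = aug (G.δ 1 x)
  surj (y : Y) : ∃ x, aug x = y
  exact_zero (x : G _⦋0⦌) (hx : aug x = 1) : x ∈ boundaries G 0
  exact_succ {n : ℕ} (x : G _⦋n + 1⦌) (hx : x ∈ cycles G (n + 1)) : x ∈ boundaries G (n + 1)

/-- Bisimplicial groups; the group of `(p, q)`-simplices of `X` is
`(X.obj (op ⦋q⦌)).obj (op ⦋p⦌)`. -/
abbrev BisimplicialGroup := SimplexCategoryᵒᵖ ⥤ SimplexCategoryᵒᵖ ⥤ GrpCat.{u}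

namespace BisimplicialGroup

variable (X : BisimplicialGroup.{u})

/-- The simplicial group `X_{*,q}`. -/
abbrev row (q : ℕ) : SimplicialObject GrpCat.{u} := X.obj (op ⦋q⦌)

/-- The simplicial group `X_{p,*}`. -/
abbrev column (p : ℕ) : SimplicialObject GrpCat.{u} := X.flip.obj (op ⦋p⦌)

/-- The simplicial operators in the first direction, as morphisms of columns. -/
abbrev columnδ {p : ℕ} (i : Fin (p + 2)) : X.column (p + 1) ⟶ X.column p :=
  X.flip.map (SimplexCategory.δ i).op

/-- The groups of the double Moore complex. -/
def doubleMoore (p q : ℕ) : Subgroup ((X.row q) _⦋p⦌) :=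
  mooreTerm (X.row q) p ⊓ mooreTerm (X.column p) q

variable {X}

lemma row_δ_mem {p q : ℕ} {x : (X.row q) _⦋p + 1⦌} (hx : x ∈ X.doubleMoore (p + 1) q) :
    (X.row q).δ 0 x ∈ X.doubleMoore p q :=
  ⟨δ_zero_mem_mooreTerm hx.1, app_mem_mooreTerm (X.columnδ 0) hx.2⟩

/-- A preimage normalized in the row direction need not be normalized in the column direction. Its
row faces, being `x` or trivial, are; so `exists_mem_mooreTerm`, applied to all row face maps of the
column at once, corrects it without changing any of them. -/
lemma exists_row {p q : ℕ} {x : (X.row q) _⦋p⦌} (hx : x ∈ mooreTerm (X.column p) q)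
    (hx' : x ∈ boundaries (X.row q) p) :
    ∃ y ∈ X.doubleMoore (p + 1) q, (X.row q).δ 0 y = x := by
  obtain ⟨y, hy, rfl⟩ := hx'
  rw [SetLike.mem_coe, mem_moore_iff] at hy
  obtain ⟨z, hz, hz'⟩ := exists_mem_mooreTerm (G := X.column (p + 1)) (n := q)
    (fun i : Fin (p + 2) => X.columnδ i) y (fun i => by
      induction i using Fin.cases with
      | zero => exact hx
      | succ i =>
        have h : (X.columnδ i.succ).app (op ⦋q⦌) y = 1 := hy i
        rw [h]
        exact one_mem _)
  exact ⟨z, ⟨mem_moore_iff.2 fun i => (hz' i.succ).trans (hy i), hz⟩, hz' 0⟩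

variable {A C : SimplicialObject GrpCat.{u}} {augA : X.column 0 ⟶ A} {augC : X.row 0 ⟶ C}

lemma exists_row_zero (hA : ∀ q, IsResolution (X.row q) (augA.app (op ⦋q⦌))) {q : ℕ}
    {a : A _⦋q⦌} (ha : a ∈ mooreTerm A q) :
    ∃ x ∈ X.doubleMoore 0 q, augA.app (op ⦋q⦌) x = a := by
  obtain ⟨x, rfl⟩ := (hA q).surj a
  obtain ⟨z, hz, hz'⟩ := exists_mem_mooreTerm (G := X.column 0) (n := q)
    (fun _ : Unit => augA) x (fun _ => ha)
  exact ⟨z, ⟨Subgroup.mem_top _, hz⟩, hz' ()⟩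

lemma exists_row_of_δ_eq_one (hA : ∀ q, IsResolution (X.row q) (augA.app (op ⦋q⦌))) {p q : ℕ}
    {x : (X.row q) _⦋p + 1⦌} (hx : x ∈ X.doubleMoore (p + 1) q) (hx' : (X.row q).δ 0 x = 1) :
    ∃ y ∈ X.doubleMoore (p + 2) q, (X.row q).δ 0 y = x :=
  exists_row hx.2 ((hA q).exact_succ x (mem_cycles_succ_iff_moore.2 ⟨hx.1, hx'⟩))

lemma exists_row_of_aug_eq_one (hA : ∀ q, IsResolution (X.row q) (augA.app (op ⦋q⦌))) {q : ℕ}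
    {x : (X.row q) _⦋0⦌} (hx : x ∈ X.doubleMoore 0 q) (hx' : augA.app (op ⦋q⦌) x = 1) :
    ∃ y ∈ X.doubleMoore 1 q, (X.row q).δ 0 y = x :=
  exists_row hx.2 ((hA q).exact_zero x hx')

/-- Every statement on columns is obtained from the one on rows through this symmetry. -/
lemma mem_doubleMoore_flip {p q : ℕ} {x : (X.row q) _⦋p⦌} :
    x ∈ doubleMoore X.flip q p ↔ x ∈ X.doubleMoore p q :=
  and_comm

lemma aug_row_δ (hA : ∀ q, IsResolution (X.row q) (augA.app (op ⦋q⦌))) {q : ℕ}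
    {x : (X.row q) _⦋1⦌} (hx : x ∈ X.doubleMoore 1 q) :
    augA.app (op ⦋q⦌) ((X.row q).δ 0 x) = 1 := by
  rw [(hA q).w, show (X.row q).δ 1 x = 1 from mem_moore_iff.1 hx.1 0, map_one]

lemma row_column_δ {p q : ℕ} (x : (X.row (q + 1)) _⦋p + 1⦌) :
    (X.row q).δ 0 ((X.column (p + 1)).δ 0 x) = (X.column p).δ 0 ((X.row (q + 1)).δ 0 x) :=
  (app_δ (X.columnδ 0) 0 x)

/-- Restriction of a homomorphism to subgroups. -/
def restrictHom {G H : Type*} [Group G] [Group H] (f : G →* H) (K : Subgroup G) (L : Subgroup H)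
    (h : ∀ x ∈ K, f x ∈ L) : K →* L :=
  (f.comp K.subtype).codRestrict L fun x => h x x.2

variable (augA augC)

/-- The double Moore complex of an augmented bisimplicial group with contractible rows and
columns. -/
def doubleResolution (hA : ∀ q, IsResolution (X.row q) (augA.app (op ⦋q⦌)))
    (hC : ∀ p, IsResolution (X.column p) (augC.app (op ⦋p⦌))) :
    DoubleResolution (fun p q => X.doubleMoore p q) (fun q => mooreTerm A q)
      (fun p => mooreTerm C p) where
  dh p q := restrictHom ((X.row q).δ 0).hom _ _ fun _ hx => row_δ_mem hx
  dv p q := restrictHom ((X.column p).δ 0).hom _ _ fun _ hx =>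
    mem_doubleMoore_flip.1 (row_δ_mem (X := X.flip) (mem_doubleMoore_flip.2 hx))
  dA q := restrictHom (A.δ 0).hom _ _ fun _ hx => δ_zero_mem_mooreTerm hx
  dC q := restrictHom (C.δ 0).hom _ _ fun _ hx => δ_zero_mem_mooreTerm hx
  augA q := restrictHom (augA.app (op ⦋q⦌)).hom _ _ fun _ hx => app_mem_mooreTerm augA hx.2
  augC p := restrictHom (augC.app (op ⦋p⦌)).hom _ _ fun _ hx => app_mem_mooreTerm augC hx.1
  dh_dv p q x := Subtype.ext (row_column_δ x.1)
  dh_dh p q x := Subtype.ext (δ_zero_δ_zero x.2.1)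
  dv_dv p q x := Subtype.ext (δ_zero_δ_zero x.2.2)
  augA_dv q x := Subtype.ext (app_δ augA 0 x.1)
  augC_dh q x := Subtype.ext (app_δ augC 0 x.1)
  augA_dh q x := Subtype.ext (aug_row_δ hA x.2)
  augC_dv p x := Subtype.ext (aug_row_δ (X := X.flip) hC (mem_doubleMoore_flip.2 x.2))
  augA_surj q a := by
    obtain ⟨x, hx, h⟩ := exists_row_zero hA a.2
    exact ⟨⟨x, hx⟩, Subtype.ext h⟩
  augC_surj p c := by
    obtain ⟨x, hx, h⟩ := exists_row_zero (X := X.flip) hC c.2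
    exact ⟨⟨x, mem_doubleMoore_flip.1 hx⟩, Subtype.ext h⟩
  augA_exact q x hx := by
    obtain ⟨y, hy, h⟩ := exists_row_of_aug_eq_one hA x.2 (congrArg Subtype.val hx)
    exact ⟨⟨y, hy⟩, Subtype.ext h⟩
  augC_exact p x hx := by
    obtain ⟨y, hy, h⟩ := exists_row_of_aug_eq_one (X := X.flip) hC
      (mem_doubleMoore_flip.2 x.2) (congrArg Subtype.val hx)
    exact ⟨⟨y, mem_doubleMoore_flip.1 hy⟩, Subtype.ext h⟩
  dh_exact p q x hx := by
    obtain ⟨y, hy, h⟩ := exists_row_of_δ_eq_one hA x.2 (congrArg Subtype.val hx)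
    exact ⟨⟨y, hy⟩, Subtype.ext h⟩
  dv_exact p q x hx := by
    obtain ⟨y, hy, h⟩ := exists_row_of_δ_eq_one (X := X.flip) hC
      (mem_doubleMoore_flip.2 x.2) (congrArg Subtype.val hx)
    exact ⟨⟨y, mem_doubleMoore_flip.1 hy⟩, Subtype.ext h⟩

end BisimplicialGroup

end GroupDiagram
namespace GroupDiagram
namespace BisimplicialGroup

/-! ### Comparison of two simplicial groups with a common bisimplicial resolution -/

section Comparison

variable {X : BisimplicialGroup.{u}} {A C : SimplicialObject GrpCat.{u}}
  {augA : X.column 0 ⟶ A} {augC : X.row 0 ⟶ C}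
  (hA : ∀ q, IsResolution (X.row q) (augA.app (op ⦋q⦌)))
  (hC : ∀ p, IsResolution (X.column p) (augC.app (op ⦋p⦌)))

lemma isCycle_iff_dA {n : ℕ} (a : mooreTerm A n) :
    DoubleResolution.IsCycle (A := fun q => mooreTerm A q)
      (doubleResolution augA augC hA hC).dA a ↔ a.1 ∈ cycles A n := by
  cases n with
  | zero => exact ⟨fun _ => Subgroup.mem_top _, fun _ => trivial⟩
  | succ n =>
    exact ⟨fun h => mem_cycles_succ_iff_moore.2 ⟨a.2, congrArg Subtype.val h⟩,
      fun h => Subtype.ext (mem_cycles_succ_iff_moore.1 h).2⟩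

lemma isCycle_iff_dC {n : ℕ} (c : mooreTerm C n) :
    DoubleResolution.IsCycle (A := fun q => mooreTerm C q)
      (doubleResolution augA augC hA hC).dC c ↔ c.1 ∈ cycles C n := by
  cases n with
  | zero => exact ⟨fun _ => Subgroup.mem_top _, fun _ => trivial⟩
  | succ n =>
    exact ⟨fun h => mem_cycles_succ_iff_moore.2 ⟨c.2, congrArg Subtype.val h⟩,
      fun h => Subtype.ext (mem_cycles_succ_iff_moore.1 h).2⟩

/-- The relation between cycles of `A` and `C` given by the double Moore complex. -/
def comparisonGraph (n : ℕ) : Subgroup (cycles A n × cycles C n) where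
  carrier := {z | ∃ x : X.doubleMoore n 0,
    (doubleResolution augA augC hA hC).Stair
      (⟨z.1, cycles_le_mooreTerm n z.1.2⟩ : mooreTerm A n) x ∧ augC.app (op ⦋n⦌) x.1 = z.2}
  one_mem' := ⟨1, DoubleResolution.Stair.one n 0 rfl, map_one _⟩
  mul_mem' := by
    rintro z z' ⟨x, hx, h⟩ ⟨x', hx', h'⟩
    exact ⟨x * x', hx.mul hx', (map_mul _ _ _).trans (congrArg₂ _ h h')⟩
  inv_mem' := by
    rintro z ⟨x, hx, h⟩
    exact ⟨x⁻¹, hx.inv, (map_inv _ _).trans (congrArg _ h)⟩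

/-- Staircases can be built forwards from any cycle of `A` and backwards from any cycle of `C`, and
`Stair.boundary_iff` matches boundaries at their two ends. -/
lemma isQuotientGraph (n : ℕ) : IsQuotientGraph
    ((boundaries A n).subgroupOf (cycles A n)) ((boundaries C n).subgroupOf (cycles C n))
    (comparisonGraph hA hC n) where
  total a := by
    obtain ⟨x, hx⟩ := DoubleResolution.exists_stair
      ((isCycle_iff_dA hA hC ⟨a, cycles_le_mooreTerm n a.2⟩).2 a.2) n 0 rfl
    exact ⟨⟨_, (isCycle_iff_dC hA hC _).1 hx.isCycle_augC⟩, x, hx, rfl⟩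
  surj c := by
    obtain ⟨a, x, hx, h⟩ := (doubleResolution augA augC hA hC).exists_stair_of_isCycle n
      ⟨c, cycles_le_mooreTerm n c.2⟩ ((isCycle_iff_dC hA hC _).2 c.2)
    exact ⟨⟨a.1, (isCycle_iff_dA hA hC a).1 hx.isCycle⟩, x, hx, congrArg Subtype.val h⟩
  mem_iff {a c} := by
    rintro ⟨x, hx, h⟩
    have key := hx.boundary_iff
    rw [Subgroup.mem_subgroupOf, Subgroup.mem_subgroupOf]
    constructor
    · rintro ⟨b, hb, hb'⟩
      obtain ⟨e, he⟩ := key.1 ⟨⟨b, hb⟩, Subtype.ext hb'⟩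
      exact ⟨e.1, e.2, (congrArg Subtype.val he).trans h⟩
    · rintro ⟨e, he, he'⟩
      obtain ⟨b, hb⟩ := key.2 ⟨⟨e, he⟩, Subtype.ext (he'.trans h.symm)⟩
      exact ⟨b.1, b.2, congrArg Subtype.val hb⟩

/-- The homotopy groups of `A` and `C` agree if both are resolved by the same bisimplicial
group. -/
noncomputable def homotopyGroupEquiv (n : ℕ) : homotopyGroup A n ≃* homotopyGroup C n :=
  (isQuotientGraph hA hC n).equiv

variable {X' : BisimplicialGroup.{u}} {A' C' : SimplicialObject GrpCat.{u}}
  {augA' : X'.column 0 ⟶ A'} {augC' : X'.row 0 ⟶ C'}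
  (hA' : ∀ q, IsResolution (X'.row q) (augA'.app (op ⦋q⦌)))
  (hC' : ∀ p, IsResolution (X'.column p) (augC'.app (op ⦋p⦌)))
  (φ : X ⟶ X') (α : A ⟶ A') (γ : C ⟶ C')

/-- The map of columns induced by a morphism of bisimplicial groups. -/
abbrev columnMap {X X' : BisimplicialGroup.{u}} (φ : X ⟶ X') (p : ℕ) :
    X.column p ⟶ X'.column p :=
  ((flipFunctor _ _ _).map φ).app (op ⦋p⦌)

-- The graph determines the value of the isomorphism, so the choices made in its construction play
-- no role: it is enough to send one staircase through `φ`.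
include φ in
lemma homotopyGroupEquiv_naturality
    (hα : augA ≫ α = columnMap φ 0 ≫ augA')
    (hγ : augC ≫ γ = φ.app (op ⦋0⦌) ≫ augC') (n : ℕ) (a : homotopyGroup A n) :
    homotopyGroupEquiv hA' hC' n (homotopyGroupMap α n a) =
      homotopyGroupMap γ n (homotopyGroupEquiv hA hC n a) := by
  induction a using QuotientGroup.induction_on with | H a =>
  obtain ⟨c, hc⟩ := (isQuotientGraph hA hC n).total a
  have hc' : (cyclesMap α n a, cyclesMap γ n c) ∈ comparisonGraph hA' hC' n := by
    obtain ⟨x, hx, h⟩ := hc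
    refine ⟨⟨(φ.app (op ⦋0⦌)).app (op ⦋n⦌) x.1, app_mem_mooreTerm (φ.app (op ⦋0⦌)) x.2.1,
      app_mem_mooreTerm (columnMap φ n) x.2.2⟩, ?_, ?_⟩
    · exact hx.map (D' := doubleResolution augA' augC' hA' hC')
        (fun p q x => ⟨(φ.app (op ⦋q⦌)).app (op ⦋p⦌) x.1, app_mem_mooreTerm (φ.app (op ⦋q⦌)) x.2.1,
          app_mem_mooreTerm (columnMap φ p) x.2.2⟩)
        (fun n a => ⟨α.app (op ⦋n⦌) a.1, app_mem_mooreTerm α a.2⟩)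
        (fun p q x => Subtype.ext (app_δ (φ.app (op ⦋q⦌)) 0 x.1))
        (fun p q x => Subtype.ext (app_δ (columnMap φ p) 0 x.1))
        (fun q x => Subtype.ext (ConcreteCategory.congr_hom (NatTrans.congr_app hα (op ⦋q⦌)) x.1))
    · refine (ConcreteCategory.congr_hom (NatTrans.congr_app hγ (op ⦋n⦌)) x.1).symm.trans ?_
      exact congrArg (γ.app (op ⦋n⦌)) h
  exact ((isQuotientGraph hA' hC' n).equiv_mk hc').trans
    (congrArg (homotopyGroupMap γ n) ((isQuotientGraph hA hC n).equiv_mk hc)).symm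

end Comparison

end BisimplicialGroup

end GroupDiagram
namespace GroupDiagram

/-! ### The two-sided bar construction -/

section Bar

variable {D : Type} [SmallCategory D] (F : D ⥤ GrpCat.{u})

/-- The free product of the groups `F(c_0)` over all sequences `c_0 → ⋯ → c_p → q`. -/
abbrev Bar (q : D) (p : ℕ) : Type u :=
  Monoid.CoprodI fun τ : (σ : ComposableArrows D p) × (σ.obj (Fin.last p) ⟶ q) => F.obj (τ.1.obj 0)

variable {q q' : D}

/-- The inclusion of a free factor. -/
abbrev barIncl {p : ℕ} (σ : ComposableArrows D p) (f : σ.obj (Fin.last p) ⟶ q) :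
    F.obj (σ.obj 0) →* Bar F q p :=
  Monoid.CoprodI.of (M := fun τ : (σ : ComposableArrows D p) × (σ.obj (Fin.last p) ⟶ q) =>
    F.obj (τ.1.obj 0)) (i := ⟨σ, f⟩)

variable {F} in
lemma bar_hom_ext {p : ℕ} {H : Type*} [Monoid H] {φ ψ : Bar F q p →* H}
    (h : ∀ σ f x, φ (barIncl F σ f x) = ψ (barIncl F σ f x)) : φ = ψ :=
  Monoid.CoprodI.ext_hom _ _ fun τ => MonoidHom.ext (h τ.1 τ.2)

/-- The homomorphism on `Bar F q p` with given values on the free factors. -/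
def barLift {p : ℕ} {H : Type*} [Monoid H]
    (φ : ∀ (σ : ComposableArrows D p) (_ : σ.obj (Fin.last p) ⟶ q), F.obj (σ.obj 0) →* H) :
    Bar F q p →* H :=
  Monoid.CoprodI.lift fun τ => φ τ.1 τ.2

@[simp]
lemma barLift_incl {p : ℕ} {H : Type*} [Monoid H]
    (φ : ∀ (σ : ComposableArrows D p) (_ : σ.obj (Fin.last p) ⟶ q), F.obj (σ.obj 0) →* H)
    (σ : ComposableArrows D p) (f : σ.obj (Fin.last p) ⟶ q) (x : F.obj (σ.obj 0)) :
    barLift F φ (barIncl F σ f x) = φ σ f x :=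
  Monoid.CoprodI.lift_of _ _

/-- The simplicial operators of the bar construction. -/
def barMap {m n : SimplexCategory} (θ : m ⟶ n) (q : D) : Bar F q n.len →* Bar F q m.len :=
  barLift F fun σ f => (barIncl F (σ.whiskerLeft θ.toOrderHom.monotone.functor)
    (σ.map (homOfLE (Fin.le_last (θ.toOrderHom (Fin.last m.len)))) ≫ f)).comp
      (F.map (σ.map (homOfLE (Fin.zero_le (θ.toOrderHom 0))))).hom

lemma barMap_incl {m n : SimplexCategory} (θ : m ⟶ n) (σ : ComposableArrows D n.len)
    (f : σ.obj (Fin.last n.len) ⟶ q) (x : F.obj (σ.obj 0)) :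
    barMap F θ q (barIncl F σ f x) =
      barIncl F (σ.whiskerLeft θ.toOrderHom.monotone.functor)
        (σ.map (homOfLE (Fin.le_last (θ.toOrderHom (Fin.last m.len)))) ≫ f)
        (F.map (σ.map (homOfLE (Fin.zero_le (θ.toOrderHom 0)))) x) :=
  barLift_incl _ _ _ _ _

/-- The map between bar constructions given by composition with `g : q ⟶ q'`. -/
def barPush (g : q ⟶ q') (p : ℕ) : Bar F q p →* Bar F q' p :=
  barLift F fun σ f => barIncl F σ (f ≫ g)

@[simp]
lemma barPush_incl (g : q ⟶ q') {p : ℕ} (σ : ComposableArrows D p)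
    (f : σ.obj (Fin.last p) ⟶ q) (x : F.obj (σ.obj 0)) :
    barPush F g p (barIncl F σ f x) = barIncl F σ (f ≫ g) x :=
  barLift_incl _ _ _ _ _

/-- The bar construction of a group diagram. -/
def bar : D ⥤ SimplexCategoryᵒᵖ ⥤ GrpCat.{u} where
  obj q :=
    { obj := fun n => GrpCat.of (Bar F q n.unop.len)
      map := fun θ => GrpCat.ofHom (barMap F θ.unop q)
      map_id := fun n => by
        ext1
        refine bar_hom_ext fun σ f x => (barMap_incl F _ σ f x).trans ?_
        have h : F.map (σ.map (𝟙 (0 : Fin (n.unop.len + 1)))) x = x := by simp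
        refine (congrArg (barIncl F σ _) h).trans ?_
        have h' : σ.map (𝟙 (Fin.last n.unop.len)) ≫ f = f := by simp
        exact congrArg (fun g => barIncl F σ g x) h'
      map_comp := fun θ ψ => by
        ext1
        refine bar_hom_ext fun σ f x => (barMap_incl F _ σ f x).trans ?_
        refine Eq.trans ?_ (congrArg (barMap F ψ.unop q) (barMap_incl F θ.unop σ f x)).symm
        refine Eq.trans ?_ (barMap_incl F ψ.unop _ _ _).symm
        refine congrArg₂ (fun g y => barIncl F
          (σ.whiskerLeft (θ ≫ ψ).unop.toOrderHom.monotone.functor) g y) ?_ ?_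
        · refine Eq.trans ?_ (Category.assoc _ _ _)
          exact congrArg (· ≫ f) (σ.map_comp _ _)
        · refine Eq.trans ?_ (ConcreteCategory.comp_apply _ _ _)
          refine ConcreteCategory.congr_hom ?_ x
          refine Eq.trans ?_ (F.map_comp _ _)
          exact congrArg F.map (σ.map_comp _ _) }
  map g :=
    { app := fun n => GrpCat.ofHom (barPush F g n.unop.len)
      naturality := fun m n θ => by
        ext1
        refine bar_hom_ext fun σ f x => ?_
        refine (congrArg (barPush F g n.unop.len) (barMap_incl F θ.unop σ f x)).trans ?_
        refine (barPush_incl F g _ _ _).trans ?_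
        refine Eq.trans ?_ (congrArg (barMap F θ.unop _) (barPush_incl F g σ f x)).symm
        refine Eq.trans ?_ (barMap_incl F θ.unop σ _ x).symm
        exact congrArg (fun g => barIncl F (σ.whiskerLeft θ.unop.toOrderHom.monotone.functor) g _)
          (Category.assoc _ _ _) }
  map_id q := by
    apply NatTrans.ext
    funext n
    ext1
    refine bar_hom_ext fun σ f x => (barPush_incl F _ σ f x).trans ?_
    exact congrArg (fun g => barIncl F σ g x) (Category.comp_id f)
  map_comp g h := by
    apply NatTrans.ext
    funext n
    ext1
    refine bar_hom_ext fun σ f x => (barPush_incl F _ σ f x).trans ?_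
    refine Eq.trans ?_ (congrArg (barPush F h n.unop.len) (barPush_incl F g σ f x)).symm
    refine Eq.trans ?_ (barPush_incl F h σ _ x).symm
    exact congrArg (fun g => barIncl F σ g x) (Category.assoc f g h).symm

/-- The map between bar constructions induced by a natural transformation. -/
def barNatHom {F F' : D ⥤ GrpCat.{u}} (t : F ⟶ F') (q : D) (p : ℕ) : Bar F q p →* Bar F' q p :=
  barLift F fun σ f => (barIncl F' σ f).comp (t.app (σ.obj 0)).hom

lemma barNatHom_incl {F F' : D ⥤ GrpCat.{u}} (t : F ⟶ F') {p : ℕ} (σ : ComposableArrows D p)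
    (f : σ.obj (Fin.last p) ⟶ q) (x : F.obj (σ.obj 0)) :
    barNatHom t q p (barIncl F σ f x) = barIncl F' σ f (t.app (σ.obj 0) x) :=
  barLift_incl _ _ _ _ _

/-- The bar construction as a functor of the group diagram, on morphisms. -/
def barNat {F F' : D ⥤ GrpCat.{u}} (t : F ⟶ F') : bar F ⟶ bar F' where
  app q :=
    { app := fun n => GrpCat.ofHom (barNatHom t q n.unop.len)
      naturality := fun m n θ => by
        ext1
        refine bar_hom_ext fun σ f x => ?_
        refine (congrArg (barNatHom t q n.unop.len) (barMap_incl F θ.unop σ f x)).trans ?_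
        refine (barNatHom_incl t _ _ _).trans ?_
        refine Eq.trans ?_ (congrArg (barMap F' θ.unop q) (barNatHom_incl t σ f x)).symm
        refine Eq.trans ?_ (barMap_incl F' θ.unop σ _ _).symm
        exact congrArg (barIncl F' (σ.whiskerLeft θ.unop.toOrderHom.monotone.functor) _)
          (ConcreteCategory.congr_hom (t.naturality _) x) }
  naturality q q' g := by
    apply NatTrans.ext
    funext n
    ext1
    refine bar_hom_ext fun σ f x => ?_
    refine (congrArg (barNatHom t q' n.unop.len) (barPush_incl F g σ f x)).trans ?_
    refine (barNatHom_incl t _ _ _).trans ?_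
    refine Eq.trans ?_ (congrArg (barPush F' g n.unop.len) (barNatHom_incl t σ f x)).symm
    exact (barPush_incl F' g σ f _).symm

/-! The augmentation of the bar construction towards the diagram. -/

/-- The augmentation `c_0 → ⋯ → c_p → q`, `x ↦ F(c_0 → q)(x)`. -/
def barAug (q : D) (p : ℕ) : Bar F q p →* F.obj q :=
  barLift F fun σ f => (F.map (σ.map (homOfLE (Fin.zero_le (Fin.last p))) ≫ f)).hom

lemma barAug_incl {p : ℕ} (σ : ComposableArrows D p) (f : σ.obj (Fin.last p) ⟶ q)
    (x : F.obj (σ.obj 0)) :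
    barAug F q p (barIncl F σ f x) =
      F.map (σ.map (homOfLE (Fin.zero_le (Fin.last p))) ≫ f) x :=
  barLift_incl _ _ _ _ _

/-- The total composite c_0 → q does not change when intermediate vertices are dropped or repeated.
-/
lemma barAug_barMap {m n : SimplexCategory} (θ : m ⟶ n) (q : D) (x : Bar F q n.len) :
    barAug F q m.len (barMap F θ q x) = barAug F q n.len x := by
  suffices h : (barAug F q m.len).comp (barMap F θ q) = barAug F q n.len from
    DFunLike.congr_fun h x
  refine bar_hom_ext fun σ f x => ?_
  refine (congrArg (barAug F q m.len) (barMap_incl F θ σ f x)).trans ?_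
  refine (barAug_incl F _ _ _).trans ?_
  refine Eq.trans ?_ (barAug_incl F σ f x).symm
  refine (ConcreteCategory.comp_apply _ _ _).symm.trans ?_
  refine ConcreteCategory.congr_hom ?_ x
  refine (F.map_comp _ _).symm.trans (congrArg F.map ?_)
  -- The arrow c_0 → q is factored at the vertices `θ 0` and `θ m`.
  change σ.map (homOfLE (Fin.zero_le (θ.toOrderHom 0))) ≫
    σ.map (homOfLE (θ.toOrderHom.monotone (Fin.zero_le (Fin.last m.len)))) ≫
      σ.map (homOfLE (Fin.le_last (θ.toOrderHom (Fin.last m.len)))) ≫ f = _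
  rw [← Functor.map_comp_assoc, ← Functor.map_comp_assoc]
  rfl

/-- The augmentation of the bar construction as a natural transformation. -/
def barAugNat : (bar F).flip.obj (op ⦋0⦌) ⟶ F where
  app q := GrpCat.ofHom (barAug F q 0)
  naturality q q' g := by
    ext1
    refine bar_hom_ext fun σ f x => ?_
    refine (congrArg (barAug F q' 0) (barPush_incl F g σ f x)).trans ?_
    refine (barAug_incl F _ _ _).trans ?_
    refine Eq.trans ?_ (congrArg (F.map g) (barAug_incl F σ f x)).symm
    refine Eq.trans ?_ (ConcreteCategory.comp_apply _ _ _)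
    refine ConcreteCategory.congr_hom ?_ x
    rw [← F.map_comp, Category.assoc]

/-- The section of the augmentation. -/
def barSection (q : D) : F.obj q →* Bar F q 0 :=
  barIncl F ((Functor.const _).obj q) (𝟙 q)

lemma barAug_barSection (x : F.obj q) : barAug F q 0 (barSection F q x) = x := by
  refine (barAug_incl F ((Functor.const _).obj q) (𝟙 q) x).trans ?_
  simp

/-! The contraction of the bar construction, appending `q` to a sequence `c_0 → ⋯ → c_p → q`. -/

/-- The functor on `{0 < ⋯ < p < ∞}` defined by a sequence `c_0 → ⋯ → c_p → q`. -/
def extendTop {p : ℕ} (σ : ComposableArrows D p) (f : σ.obj (Fin.last p) ⟶ q) :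
    WithTop (Fin (p + 1)) ⥤ D where
  obj := fun i => match i with
    | none => q
    | some i => σ.obj i
  map := fun {i j} h => match i, j, h with
    | none, none, _ => 𝟙 q
    | some i, none, _ => σ.map (homOfLE (Fin.le_last i)) ≫ f
    | some i, some j, h => σ.map (homOfLE (WithTop.coe_le_coe.1 (leOfHom h)))
    | none, some j, h => absurd (leOfHom h) (WithTop.not_top_le_coe j)
  map_id := by
    rintro (_ | i)
    · rfl
    · exact σ.map_id i
  map_comp := by
    rintro (_ | i) (_ | j) (_ | k) h h'
    · exact (Category.comp_id _).symm
    · exact absurd (leOfHom h') (WithTop.not_top_le_coe k)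
    · exact absurd (leOfHom h) (WithTop.not_top_le_coe j)
    · exact absurd (leOfHom h) (WithTop.not_top_le_coe j)
    · exact (Category.comp_id _).symm
    · exact absurd (leOfHom h') (WithTop.not_top_le_coe k)
    · refine Eq.trans ?_ (Category.assoc _ _ _)
      exact congrArg (· ≫ f) (σ.map_comp _ _)
    · exact σ.map_comp _ _

end Bar

end GroupDiagram
namespace GroupDiagram

/-! ### The extra degeneracy of the bar construction -/

section Contraction

variable {D : Type} [SmallCategory D] (F : D ⥤ GrpCat.{u}) {q : D}

/-- The elements of the bar construction given by a diagram `S` on a preorder. -/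
def barElement {P : Type} [Preorder P] (S : P ⥤ D) {b t : P} (g : S.obj t ⟶ q) {m : ℕ}
    (τ : Fin (m + 1) →o P) (hb : b ≤ τ 0) (ht : τ (Fin.last m) ≤ t) :
    F.obj (S.obj b) →* Bar F q m :=
  (barIncl F (τ.monotone.functor ⋙ S) (S.map (homOfLE ht) ≫ g)).comp
    (F.map (S.map (homOfLE hb))).hom

/-- With the diagram `S` fixed, simplicial operators act only on the monotone map `τ`. Identities
between chains in `D` thereby become identities between monotone maps into `P`, which involve no
transport along equalities of objects. -/
lemma barMap_barElement {P : Type} [Preorder P] (S : P ⥤ D) {b t : P} (g : S.obj t ⟶ q)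
    {m n : SimplexCategory} (θ : m ⟶ n) (τ : Fin (n.len + 1) →o P)
    (hb : b ≤ τ 0) (ht : τ (Fin.last n.len) ≤ t) (τ' : Fin (m.len + 1) →o P)
    (h : τ.comp θ.toOrderHom = τ') (hb' : b ≤ τ' 0) (ht' : τ' (Fin.last m.len) ≤ t)
    (x : F.obj (S.obj b)) :
    barMap F θ q (barElement F S g τ hb ht x) = barElement F S g τ' hb' ht' x := by
  subst h
  refine (barMap_incl F θ _ _ _).trans ?_
  refine congrArg₂ (fun k y => barIncl F ((τ.comp θ.toOrderHom).monotone.functor ⋙ S) k y) ?_ ?_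
  · refine (Category.assoc _ _ _).symm.trans (congrArg (· ≫ g) ?_)
    exact (S.map_comp _ _).symm
  · refine (ConcreteCategory.comp_apply _ _ _).symm.trans ?_
    refine ConcreteCategory.congr_hom ?_ x
    exact (F.map_comp _ _).symm.trans (congrArg F.map (S.map_comp _ _).symm)

lemma barElement_congr {P : Type} [Preorder P] {S S' : P ⥤ D} (h : S = S') {b t : P}
    (g : S.obj t ⟶ q) (g' : S'.obj t ⟶ q) (hg : g = eqToHom (by rw [h]) ≫ g')
    {m : ℕ} (τ : Fin (m + 1) →o P) (hb : b ≤ τ 0) (ht : τ (Fin.last m) ≤ t)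
    (x : F.obj (S.obj b)) (x' : F.obj (S'.obj b)) (hx : x' = F.map (eqToHom (by rw [h])) x) :
    barElement F S g τ hb ht x = barElement F S' g' τ hb ht x' := by
  subst h
  obtain rfl : g = g' := by simpa using hg
  obtain rfl : x' = x := by simpa using hx
  rfl

lemma barElement_comp {P P' : Type} [Preorder P] [Preorder P'] (S : P ⥤ D) (ρ : P' →o P)
    {b t : P} {b' t' : P'} (g : S.obj t ⟶ q) (h : b ≤ ρ b') (h' : ρ t' ≤ t) {m : ℕ}
    (τ : Fin (m + 1) →o P') (hb : b' ≤ τ 0) (ht : τ (Fin.last m) ≤ t') (x : F.obj (S.obj b)) :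
    barElement F (ρ.monotone.functor ⋙ S) (b := b') (t := t') (S.map (homOfLE h') ≫ g) τ hb ht
      (F.map (S.map (homOfLE h)) x) =
      barElement F S g (ρ.comp τ) (h.trans (ρ.monotone hb)) ((ρ.monotone ht).trans h') x := by
  refine congrArg₂ (fun k y => barIncl F ((ρ.comp τ).monotone.functor ⋙ S) k y) ?_ ?_
  · refine (Category.assoc _ _ _).symm.trans (congrArg (· ≫ g) ?_)
    exact (S.map_comp _ _).symm
  · refine (ConcreteCategory.comp_apply _ _ _).symm.trans ?_
    refine ConcreteCategory.congr_hom ?_ x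
    exact (F.map_comp _ _).symm.trans (congrArg F.map (S.map_comp _ _).symm)

/-- The monotone map on `WithTop` induced by a monotone map. -/
def withTopMap {m n : ℕ} (θ : Fin (m + 1) →o Fin (n + 1)) :
    WithTop (Fin (m + 1)) →o WithTop (Fin (n + 1)) :=
  ⟨WithTop.map θ, WithTop.monotone_map_iff.2 θ.monotone⟩

/-- The added vertex is untouched by `θ`, and the objects agree definitionally, so only identity
transports occur. -/
lemma extendTop_whiskerLeft {m n : ℕ} (θ : Fin (m + 1) →o Fin (n + 1))
    (σ : ComposableArrows D n) (f : σ.obj (Fin.last n) ⟶ q) :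
    extendTop (σ.whiskerLeft θ.monotone.functor)
      (σ.map (homOfLE (Fin.le_last (θ (Fin.last m)))) ≫ f) =
        (withTopMap θ).monotone.functor ⋙ extendTop σ f := by
  refine CategoryTheory.Functor.ext ?_ ?_
  · rintro (_ | i)
    · rfl
    · rfl
  · rintro (_ | i) (_ | j) h
    · exact (by simp : (𝟙 q : q ⟶ q) = 𝟙 q ≫ 𝟙 q ≫ 𝟙 q)
    · exact absurd (leOfHom h) (WithTop.not_top_le_coe j)
    · refine Eq.trans ?_ (Category.id_comp _).symm
      refine Eq.trans ?_ (Category.comp_id _).symm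
      refine (Category.assoc _ _ _).symm.trans ?_
      exact congrArg (· ≫ f) (σ.map_comp _ _).symm
    · refine Eq.trans ?_ (Category.id_comp _).symm
      exact (Category.comp_id _).symm

/-- The isomorphism of `{0 < ⋯ < p + 1}` with `{0 < ⋯ < p < ∞}`. -/
def finToWithTop (p : ℕ) : Fin (p + 2) →o WithTop (Fin (p + 1)) where
  toFun := Fin.lastCases ⊤ (fun i => (i : WithTop (Fin (p + 1))))
  monotone' := by
    intro i j h
    induction j using Fin.lastCases with
    | last => simp
    | cast j =>
      induction i using Fin.lastCases with
      | last => exact absurd h (not_le.2 (Fin.castSucc_lt_last j))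
      | cast i => simpa using h

@[simp]
lemma finToWithTop_castSucc {p : ℕ} (i : Fin (p + 1)) : finToWithTop p i.castSucc = i := by
  change Fin.lastCases (motive := fun _ => WithTop (Fin (p + 1))) _ _ i.castSucc = i
  rw [Fin.lastCases_castSucc]

@[simp]
lemma finToWithTop_last (p : ℕ) : finToWithTop p (Fin.last (p + 1)) = ⊤ := by
  change Fin.lastCases (motive := fun _ => WithTop (Fin (p + 1))) _ _ (Fin.last (p + 1)) = _
  rw [Fin.lastCases_last]

lemma coe_zero_le_finToWithTop (p : ℕ) : ((0 : Fin (p + 1)) : WithTop (Fin (p + 1))) ≤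
    finToWithTop p 0 := by
  exact (finToWithTop_castSucc (0 : Fin (p + 1))).ge

/-- The inclusion of `{0 < ⋯ < p}` into `{0 < ⋯ < p < ∞}`. -/
def coeWithTop (p : ℕ) : Fin (p + 1) →o WithTop (Fin (p + 1)) :=
  ⟨fun i => i, WithTop.coe_strictMono.monotone⟩

lemma barIncl_eq_barElement {p : ℕ} (σ : ComposableArrows D p) (f : σ.obj (Fin.last p) ⟶ q)
    (x : F.obj (σ.obj 0)) :
    barElement F (extendTop σ f) (b := ((0 : Fin (p + 1)) : WithTop (Fin (p + 1)))) (t := ⊤) (𝟙 q)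
      (coeWithTop p) le_rfl le_top x = barIncl F σ f x := by
  refine congrArg₂ (fun k y => barIncl F σ k y) ?_ ?_
  · exact (Category.comp_id (σ.map (homOfLE (Fin.le_last (Fin.last p))) ≫ f)).trans
      (by simp [homOfLE_refl])
  · have h : F.map (σ.map (𝟙 (0 : Fin (p + 1)))) x = x := by simp
    exact h

/-- The contraction of the bar construction. -/
def barContraction (q : D) (p : ℕ) : Bar F q p →* Bar F q (p + 1) :=
  barLift F fun σ f => barElement F (extendTop σ f)
    (b := ((0 : Fin (p + 1)) : WithTop (Fin (p + 1)))) (t := ⊤) (𝟙 q)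
    (finToWithTop p) (coe_zero_le_finToWithTop p) le_top

lemma barContraction_incl {p : ℕ} (σ : ComposableArrows D p) (f : σ.obj (Fin.last p) ⟶ q)
    (x : F.obj (σ.obj 0)) :
    barContraction F q p (barIncl F σ f x) = barElement F (extendTop σ f)
      (b := ((0 : Fin (p + 1)) : WithTop (Fin (p + 1)))) (t := ⊤) (𝟙 q)
      (finToWithTop p) (coe_zero_le_finToWithTop p) le_top x :=
  barLift_incl _ _ _ _ _

lemma barMap_last_barContraction {p : ℕ} (x : Bar F q p) :
    barMap F (SimplexCategory.δ (Fin.last (p + 1))) q (barContraction F q p x) = x := by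
  suffices h : (barMap F (SimplexCategory.δ (Fin.last (p + 1))) q).comp (barContraction F q p) =
    MonoidHom.id _ from DFunLike.congr_fun h x
  refine bar_hom_ext fun σ f x => ?_
  refine (congrArg (barMap F (SimplexCategory.δ (Fin.last (p + 1))) q) (barContraction_incl F σ f x)).trans ?_
  refine Eq.trans ?_ (barIncl_eq_barElement F σ f x)
  refine barMap_barElement F _ _ _ _ _ _ _ ?_ _ _ _
  ext i : 2
  change finToWithTop p ((Fin.last (p + 1)).succAbove i) = i
  rw [Fin.succAbove_last, finToWithTop_castSucc]

/-- Deleting any vertex other than the appended one commutes with appending. Both sides are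
rewritten as `barElement`s of the same extended diagram, which leaves an equality of monotone maps.
-/
lemma barMap_barContraction {p : ℕ} (i : Fin (p + 2)) (x : Bar F q (p + 1)) :
    barMap F (SimplexCategory.δ i.castSucc) q (barContraction F q (p + 1) x) =
      barContraction F q p (barMap F (SimplexCategory.δ i) q x) := by
  suffices h : (barMap F (SimplexCategory.δ i.castSucc) q).comp (barContraction F q (p + 1)) =
    (barContraction F q p).comp (barMap F (SimplexCategory.δ i) q) from DFunLike.congr_fun h x
  refine bar_hom_ext fun σ f x => ?_
  refine (congrArg (barMap F (SimplexCategory.δ i.castSucc) q) (barContraction_incl F σ f x)).trans ?_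
  refine Eq.trans ?_ (congrArg (barContraction F q p)
    (barMap_incl F (SimplexCategory.δ i) σ f x)).symm
  refine Eq.trans ?_ (barContraction_incl F _ _ _).symm
  refine Eq.trans ?_ (barElement_congr F (extendTop_whiskerLeft
    (SimplexCategory.δ i).toOrderHom σ f) _ (𝟙 q) (Category.id_comp _).symm _ _ _ _ _ rfl).symm
  refine Eq.trans ?_ ((congrArg₂ (fun k y => barElement F
    ((withTopMap (SimplexCategory.δ i).toOrderHom).monotone.functor ⋙ extendTop σ f)
    (b := ((0 : Fin (p + 1)) : WithTop (Fin (p + 1)))) (t := ⊤) k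
    (finToWithTop p) (coe_zero_le_finToWithTop p) le_top y) ?_ ?_).trans
    (barElement_comp F (extendTop σ f) (withTopMap (SimplexCategory.δ i).toOrderHom)
    (b := ((0 : Fin (p + 2)) : WithTop (Fin (p + 2)))) (t := ⊤) (𝟙 q)
    (WithTop.coe_le_coe.2 (Fin.zero_le _)) le_top (finToWithTop p) (coe_zero_le_finToWithTop p)
    le_top x)).symm
  · refine barMap_barElement F _ _ _ _ _ _ _ ?_ _ _ _
    ext j : 2
    change finToWithTop (p + 1) (i.castSucc.succAbove j) =
      WithTop.map i.succAbove (finToWithTop p j)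
    induction j using Fin.lastCases with
    | last =>
      rw [finToWithTop_last, WithTop.map_top, Fin.succAbove_of_le_castSucc,
        Fin.succ_last, finToWithTop_last]
      simpa using Fin.le_last i
    | cast j => 
      rw [finToWithTop_castSucc, WithTop.map_coe, Fin.castSucc_succAbove_castSucc, finToWithTop_castSucc]
  · exact (Category.id_comp _).symm
  · have h : F.map (𝟙 _) (F.map (σ.map (homOfLE (Fin.zero_le
      ((SimplexCategory.δ i).toOrderHom 0)))) x) = F.map (σ.map (homOfLE (Fin.zero_le
      ((SimplexCategory.δ i).toOrderHom 0)))) x := by simp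
    exact h

/-- Deleting c_0 from c_0 → q = q leaves the one-term chain q and moves the element along c_0 → q,
which is what the augmentation does. -/
lemma barMap_zero_barContraction (x : Bar F q 0) :
    barMap F (SimplexCategory.δ (0 : Fin 2)) q (barContraction F q 0 x) =
      barSection F q (barAug F q 0 x) := by
  suffices h : (barMap F (SimplexCategory.δ (0 : Fin 2)) q).comp (barContraction F q 0) =
    (barSection F q).comp (barAug F q 0) from DFunLike.congr_fun h x
  refine bar_hom_ext fun σ f x => ?_
  refine (congrArg (barMap F (SimplexCategory.δ (0 : Fin 2)) q) (barContraction_incl F σ f x)).trans ?_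
  refine Eq.trans ?_ (congrArg (barSection F q) (barAug_incl F σ f x)).symm
  refine (barMap_barElement F _ _ _ _ _ _ (OrderHom.const _ ⊤) ?_ le_top le_top _).trans ?_
  · ext j : 2
    change finToWithTop 0 ((0 : Fin 2).succAbove j) = ⊤
    rw [Fin.succAbove_zero, Subsingleton.elim (α := Fin 1) j (Fin.last 0), Fin.succ_last, finToWithTop_last]
  · refine congrArg₂ (fun k y => barIncl F ((Functor.const _).obj q) k y) ?_ rfl
    exact Category.comp_id (𝟙 q)

/-- On a cycle the contraction has its last face equal to the cycle and all others trivial;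
`mem_boundaries_of_face` turns the last face into the face 0 that defines boundaries. -/
lemma isResolution_bar (q : D) :
    IsResolution ((bar F).obj q) ((barAugNat F).app q) where
  w x := (barAug_barMap F (SimplexCategory.δ (0 : Fin 2)) q x).trans
    (barAug_barMap F (SimplexCategory.δ (1 : Fin 2)) q x).symm
  surj y := ⟨barSection F q y, barAug_barSection F y⟩
  exact_zero x hx := by
    refine mem_boundaries_of_face (Subgroup.mem_top _) 1 (barContraction F q 0 x)
      (barMap_last_barContraction F x) fun j hj => ?_
    obtain rfl : j = 0 := by fin_cases j <;> simp_all
    exact (barMap_zero_barContraction F x).trans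
      ((congrArg (barSection F q) hx).trans (map_one _))
  exact_succ {n} x hx := by
    refine mem_boundaries_of_face hx (Fin.last _) (barContraction F q (n + 1) x)
      (barMap_last_barContraction F x) fun j hj => ?_
    obtain ⟨j, rfl⟩ := Fin.exists_castSucc_eq.2 hj
    exact (barMap_barContraction F j x).trans
      ((congrArg (barContraction F q n) (mem_cycles_succ_iff.1 hx j)).trans (map_one _))

end Contraction

end GroupDiagram
namespace GroupDiagram

/-! ### Projection of the bar construction to the simplicial replacement -/

section Forget

variable {D : Type} [SmallCategory D] (F : D ⥤ GrpCat.{u}) {q : D}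

/-- The projection `(c_0 → ⋯ → c_p → q) ↦ (c_0 → ⋯ → c_p)` in degree `p`. -/
def barForgetHom (q : D) (p : ℕ) : Bar F q p →* Replacement F p :=
  barLift F fun σ _ => incl F σ

lemma barForgetHom_incl {p : ℕ} (σ : ComposableArrows D p) (f : σ.obj (Fin.last p) ⟶ q)
    (x : F.obj (σ.obj 0)) : barForgetHom F q p (barIncl F σ f x) = incl F σ x :=
  barLift_incl _ _ _ _ _

/-- The projection from the bar construction to the simplicial replacement. -/
def barForget (q : D) : (bar F).obj q ⟶ simplicialReplacementObj F where
  app n := GrpCat.ofHom (barForgetHom F q n.unop.len)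
  naturality m n θ := by
    ext1
    refine bar_hom_ext fun σ f x => ?_
    refine (congrArg (barForgetHom F q n.unop.len) (barMap_incl F θ.unop σ f x)).trans ?_
    refine (barForgetHom_incl F _ _ _).trans ?_
    refine Eq.trans ?_ (congrArg (replacementMap F θ.unop) (barForgetHom_incl F σ f x)).symm
    exact (replacementMap_incl F θ.unop σ x).symm

lemma barForgetHom_barPush {q q' : D} (g : q ⟶ q') {p : ℕ} (x : Bar F q p) :
    barForgetHom F q' p (barPush F g p x) = barForgetHom F q p x := by
  suffices h : (barForgetHom F q' p).comp (barPush F g p) = barForgetHom F q p from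
    DFunLike.congr_fun h x
  refine bar_hom_ext fun σ f x => ?_
  refine (congrArg (barForgetHom F q' p) (barPush_incl F g σ f x)).trans ?_
  exact (barForgetHom_incl F _ _ _).trans (barForgetHom_incl F _ _ _).symm

end Forget

/-! ### Contraction of the columns over Δ^op, and the homology of a simplicial group -/

section Simplex

/-- Prepending the vertex `0` to a simplex of `Δ[c]`. -/
def consZero {q : ℕ} {c : SimplexCategory} (f : ⦋q⦌ ⟶ c) : ⦋q + 1⦌ ⟶ c :=
  SimplexCategory.Hom.mk
    { toFun := Fin.cons (α := fun _ => Fin (c.len + 1)) 0 f.toOrderHom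
      monotone' := by
        intro i j h
        induction i using Fin.cases with
        | zero => exact Fin.zero_le _
        | succ i =>
          induction j using Fin.cases with
          | zero => exact absurd h (not_le.2 (Fin.succ_pos i))
          | succ j => exact f.toOrderHom.monotone (Fin.succ_le_succ_iff.1 h) }

/-- Together with the next two lemmas: prepending 0 is an extra degeneracy contracting Δ[c] to its
vertex 0. -/
lemma δ_zero_comp_consZero {q : ℕ} {c : SimplexCategory} (f : ⦋q⦌ ⟶ c) :
    SimplexCategory.δ 0 ≫ consZero f = f := by
  ext i : 3
  rfl

lemma δ_succ_comp_consZero {q : ℕ} {c : SimplexCategory} (f : ⦋q + 1⦌ ⟶ c) (i : Fin (q + 2)) :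
    SimplexCategory.δ i.succ ≫ consZero f = consZero (SimplexCategory.δ i ≫ f) := by
  ext j : 3
  change Fin.cons (α := fun _ => Fin (c.len + 1)) 0 f.toOrderHom (i.succ.succAbove j) =
    Fin.cons (α := fun _ => Fin (c.len + 1)) 0 (SimplexCategory.δ i ≫ f).toOrderHom j
  induction j using Fin.cases with
  | zero => rfl
  | succ j =>
    rw [Fin.succ_succAbove_succ]
    rfl

lemma δ_one_comp_consZero {c : SimplexCategory} (f : ⦋0⦌ ⟶ c) :
    SimplexCategory.δ 1 ≫ consZero f = SimplexCategory.const ⦋0⦌ c 0 := by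
  ext j : 3
  obtain rfl : j = 0 := Subsingleton.elim (α := Fin 1) _ _
  rfl

variable (A : SimplicialObject GrpCat.{u})

/-- The bisimplicial group resolving both a simplicial group `A` and the simplicial replacement
of `A`. -/
abbrev biBar : BisimplicialGroup.{u} := bar (D := SimplexCategoryᵒᵖ) A

/-- The contraction of the columns of `biBar A`. -/
def columnContraction (p q : ℕ) :
    Bar (D := SimplexCategoryᵒᵖ) A (op ⦋q⦌) p →* Bar (D := SimplexCategoryᵒᵖ) A (op ⦋q + 1⦌) p :=
  barLift _ fun σ f => barIncl (D := SimplexCategoryᵒᵖ) A σ (consZero f.unop).op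

/-- The section of the projection from the column `p` to the simplicial replacement. -/
def columnSection (p : ℕ) :
    Replacement (C := SimplexCategoryᵒᵖ) A p →* Bar (D := SimplexCategoryᵒᵖ) A (op ⦋0⦌) p :=
  Monoid.CoprodI.lift fun σ => barIncl (D := SimplexCategoryᵒᵖ) A σ
    (SimplexCategory.const ⦋0⦌ (σ.obj (Fin.last p)).unop 0).op

variable {A} {p q : ℕ}

lemma columnSection_incl (σ : ComposableArrows SimplexCategoryᵒᵖ p) (x : A.obj (σ.obj 0)) :
    columnSection A p (incl (C := SimplexCategoryᵒᵖ) A σ x) =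
      barIncl (D := SimplexCategoryᵒᵖ) A σ
        (SimplexCategory.const ⦋0⦌ (σ.obj (Fin.last p)).unop 0).op x :=
  Monoid.CoprodI.lift_of _ _

lemma columnContraction_incl (σ : ComposableArrows SimplexCategoryᵒᵖ p)
    (f : σ.obj (Fin.last p) ⟶ op ⦋q⦌) (x : A.obj (σ.obj 0)) :
    columnContraction A p q (barIncl (D := SimplexCategoryᵒᵖ) A σ f x) =
      barIncl (D := SimplexCategoryᵒᵖ) A σ (consZero f.unop).op x :=
  barLift_incl (D := SimplexCategoryᵒᵖ) _ _ _ _ _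

lemma columnSection_spec (x : Replacement (C := SimplexCategoryᵒᵖ) A p) :
    barForgetHom (D := SimplexCategoryᵒᵖ) A (op ⦋0⦌) p (columnSection A p x) = x := by
  suffices h : (barForgetHom (D := SimplexCategoryᵒᵖ) A (op ⦋0⦌) p).comp (columnSection A p) =
    MonoidHom.id _ from DFunLike.congr_fun h x
  refine replacement_hom_ext fun σ x => ?_
  refine (congrArg (barForgetHom (D := SimplexCategoryᵒᵖ) A (op ⦋0⦌) p)
    (columnSection_incl σ x)).trans ?_
  exact barForgetHom_incl (D := SimplexCategoryᵒᵖ) A _ _ _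

lemma barPush_zero_columnContraction (x : Bar (D := SimplexCategoryᵒᵖ) A (op ⦋q⦌) p) :
    barPush (D := SimplexCategoryᵒᵖ) A (SimplexCategory.δ 0).op p (columnContraction A p q x) =
      x := by
  suffices h : (barPush (D := SimplexCategoryᵒᵖ) A (SimplexCategory.δ 0).op p).comp
    (columnContraction A p q) = MonoidHom.id _ from DFunLike.congr_fun h x
  refine bar_hom_ext fun σ f x => ?_
  refine (congrArg (barPush (D := SimplexCategoryᵒᵖ) A (SimplexCategory.δ 0).op p)
    (columnContraction_incl σ f x)).trans ?_
  refine (barPush_incl (D := SimplexCategoryᵒᵖ) A _ _ _ _).trans ?_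
  exact congrArg (fun g => barIncl (D := SimplexCategoryᵒᵖ) A σ g x)
    (congrArg Quiver.Hom.op (δ_zero_comp_consZero f.unop))

lemma barPush_succ_columnContraction (i : Fin (q + 2))
    (x : Bar (D := SimplexCategoryᵒᵖ) A (op ⦋q + 1⦌) p) :
    barPush (D := SimplexCategoryᵒᵖ) A (SimplexCategory.δ i.succ).op p
      (columnContraction A p (q + 1) x) =
      columnContraction A p q (barPush (D := SimplexCategoryᵒᵖ) A (SimplexCategory.δ i).op p x) := by
  suffices h : (barPush (D := SimplexCategoryᵒᵖ) A (SimplexCategory.δ i.succ).op p).comp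
    (columnContraction A p (q + 1)) = (columnContraction A p q).comp
      (barPush (D := SimplexCategoryᵒᵖ) A (SimplexCategory.δ i).op p) from DFunLike.congr_fun h x
  refine bar_hom_ext fun σ f x => ?_
  refine (congrArg (barPush (D := SimplexCategoryᵒᵖ) A (SimplexCategory.δ i.succ).op p)
    (columnContraction_incl σ f x)).trans ?_
  refine (barPush_incl (D := SimplexCategoryᵒᵖ) A _ _ _ _).trans ?_
  refine Eq.trans ?_ (congrArg (columnContraction A p q)
    (barPush_incl (D := SimplexCategoryᵒᵖ) A (SimplexCategory.δ i).op σ f x)).symm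
  refine Eq.trans ?_ (columnContraction_incl σ _ x).symm
  exact congrArg (fun g => barIncl (D := SimplexCategoryᵒᵖ) A σ g x)
    (congrArg Quiver.Hom.op (δ_succ_comp_consZero f.unop i))

lemma barPush_one_columnContraction (x : Bar (D := SimplexCategoryᵒᵖ) A (op ⦋0⦌) p) :
    barPush (D := SimplexCategoryᵒᵖ) A (SimplexCategory.δ 1).op p (columnContraction A p 0 x) =
      columnSection A p (barForgetHom (D := SimplexCategoryᵒᵖ) A (op ⦋0⦌) p x) := by
  suffices h : (barPush (D := SimplexCategoryᵒᵖ) A (SimplexCategory.δ 1).op p).comp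
    (columnContraction A p 0) = (columnSection A p).comp
      (barForgetHom (D := SimplexCategoryᵒᵖ) A (op ⦋0⦌) p) from DFunLike.congr_fun h x
  refine bar_hom_ext fun σ f x => ?_
  refine (congrArg (barPush (D := SimplexCategoryᵒᵖ) A (SimplexCategory.δ 1).op p)
    (columnContraction_incl σ f x)).trans ?_
  refine (barPush_incl (D := SimplexCategoryᵒᵖ) A _ _ _ _).trans ?_
  refine Eq.trans ?_ (congrArg (columnSection A p)
    (barForgetHom_incl (D := SimplexCategoryᵒᵖ) A σ f x)).symm
  refine Eq.trans ?_ (columnSection_incl σ x).symm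
  exact congrArg (fun g => barIncl (D := SimplexCategoryᵒᵖ) A σ g x)
    (congrArg Quiver.Hom.op (δ_one_comp_consZero f.unop))

variable (A)

/-- The augmentation of `biBar A` towards `A`. -/
abbrev biBarAug : (biBar A).column 0 ⟶ A := barAugNat (D := SimplexCategoryᵒᵖ) A

/-- The augmentation of `biBar A` towards the simplicial replacement. -/
abbrev biBarForget :
    (biBar A).row 0 ⟶ (simplicialReplacement SimplexCategoryᵒᵖ).obj A :=
  barForget (D := SimplexCategoryᵒᵖ) A (op ⦋0⦌)

lemma isResolution_row (q : ℕ) :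
    IsResolution ((biBar A).row q) ((biBarAug A).app (op ⦋q⦌)) :=
  isResolution_bar (D := SimplexCategoryᵒᵖ) A (op ⦋q⦌)

/-- The column is a free product over σ of copies of A(c_0) indexed by the simplices of Δ[c_p], and
prepending 0 acts on the indices. The contraction has face 0 equal to the given simplex, so a cycle
is directly exhibited as a boundary. -/
lemma isResolution_column (p : ℕ) :
    IsResolution ((biBar A).column p) ((biBarForget A).app (op ⦋p⦌)) where
  w x := (barForgetHom_barPush (D := SimplexCategoryᵒᵖ) A (SimplexCategory.δ 0).op x).trans
    (barForgetHom_barPush (D := SimplexCategoryᵒᵖ) A (SimplexCategory.δ 1).op x).symm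
  surj y := ⟨columnSection A p y, columnSection_spec y⟩
  exact_zero x hx := by
    refine mem_boundaries_of_face (Subgroup.mem_top _) 0 (columnContraction A p 0 x)
      (barPush_zero_columnContraction x) fun j hj => ?_
    obtain rfl : j = 1 := by fin_cases j <;> simp_all
    exact (barPush_one_columnContraction x).trans
      ((congrArg (columnSection A p) hx).trans (map_one _))
  exact_succ {n} x hx := by
    refine mem_boundaries_of_face hx 0 (columnContraction A p (n + 1) x)
      (barPush_zero_columnContraction x) fun j hj => ?_
    obtain ⟨j, rfl⟩ := Fin.exists_succ_eq.2 hj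
    exact (barPush_succ_columnContraction j x).trans
      ((congrArg (columnContraction A p n) (mem_cycles_succ_iff.1 hx j)).trans (map_one _))

/-- The non-Abelian homology of a simplicial group `A`, as a functor on `Δ^op`, is `π_n(A)`. -/
noncomputable def colimNSimplexIso (n : ℕ) :
    (piFunctor n : SimplicialObject GrpCat.{u} ⥤ GrpCat.{u}) ≅ colimN SimplexCategoryᵒᵖ n :=
  NatIso.ofComponents
    (fun A => (BisimplicialGroup.homotopyGroupEquiv (isResolution_row A)
      (isResolution_column A) n).toGrpIso)
    (fun {A A'} φ => by
      ext1
      refine MonoidHom.ext fun a => ?_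
      refine BisimplicialGroup.homotopyGroupEquiv_naturality (isResolution_row A)
        (isResolution_column A) (isResolution_row A') (isResolution_column A')
        (barNat (D := SimplexCategoryᵒᵖ) φ) φ
        ((simplicialReplacement SimplexCategoryᵒᵖ).map φ) ?_ ?_ n a
      · apply NatTrans.ext
        funext q
        ext1
        refine bar_hom_ext fun σ f x => ?_
        refine (congrArg (φ.app q) (barAug_incl (D := SimplexCategoryᵒᵖ) A σ f x)).trans ?_
        refine Eq.trans ?_ (congrArg (barAug (D := SimplexCategoryᵒᵖ) A' q 0)
          (barNatHom_incl (D := SimplexCategoryᵒᵖ) φ σ f x)).symm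
        refine Eq.trans ?_ (barAug_incl (D := SimplexCategoryᵒᵖ) A' σ f _).symm
        exact ConcreteCategory.congr_hom (φ.naturality _) x
      · apply NatTrans.ext
        funext m
        ext1
        refine bar_hom_ext fun σ f x => ?_
        refine (congrArg (replacementNat (C := SimplexCategoryᵒᵖ) φ m.unop.len)
          (barForgetHom_incl (D := SimplexCategoryᵒᵖ) A σ f x)).trans ?_
        refine (replacementNat_incl (C := SimplexCategoryᵒᵖ) φ σ x).trans ?_
        refine Eq.trans ?_ (congrArg (barForgetHom (D := SimplexCategoryᵒᵖ) A' _ m.unop.len)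
          (barNatHom_incl (D := SimplexCategoryᵒᵖ) φ σ f x)).symm
        exact (barForgetHom_incl (D := SimplexCategoryᵒᵖ) A' σ f _).symm)

end Simplex

end GroupDiagram
namespace GroupDiagram

/-! ### The left Kan extension along the functor `Q_X` -/

section Kan

variable {X : SSet.{u}} (G : (SimplexOver X)ᵒᵖ ⥤ GrpCat.{u})

/-- The free product of the groups `G(x)` over all simplices `x : Δ[k] ⟶ X`. -/
abbrev KanGroup (k : SimplexCategory) : Type u :=
  Monoid.CoprodI fun x : simplexYoneda.{u}.obj k ⟶ X => G.obj (op (CostructuredArrow.mk x))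

/-- The inclusion of a free factor. -/
abbrev kanIncl {k : SimplexCategory} (x : simplexYoneda.{u}.obj k ⟶ X) :
    G.obj (op (CostructuredArrow.mk x)) →* KanGroup G k :=
  Monoid.CoprodI.of (M := fun x : simplexYoneda.{u}.obj k ⟶ X =>
    G.obj (op (CostructuredArrow.mk x))) (i := x)

variable {G} in
lemma kan_hom_ext {k : SimplexCategory} {H : Type*} [Monoid H] {φ ψ : KanGroup G k →* H}
    (h : ∀ x g, φ (kanIncl G x g) = ψ (kanIncl G x g)) : φ = ψ :=
  Monoid.CoprodI.ext_hom _ _ fun x => MonoidHom.ext (h x)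

/-- The source of an arrow into `c` is determined by its underlying map in Δ. This identifies
factors whose indexing simplices are equal only propositionally, without explicit transport. -/
lemma kanIncl_congr {k : SimplexCategory} {x y : simplexYoneda.{u}.obj k ⟶ X} {c : SimplexOver X}
    (f : CostructuredArrow.mk x ⟶ c) (f' : CostructuredArrow.mk y ⟶ c) (h : f.left = f'.left)
    (g : G.obj (op c)) : kanIncl G x (G.map f.op g) = kanIncl G y (G.map f'.op g) := by
  obtain rfl : x = y := by
    have hx := CostructuredArrow.w f
    have hy := CostructuredArrow.w f'
    rw [h] at hx
    exact hx.symm.trans hy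
  obtain rfl : f = f' := CostructuredArrow.hom_ext _ _ h
  rfl

/-- The simplicial operators of the Kan extension. -/
def kanMap {m n : SimplexCategory} (θ : m ⟶ n) : KanGroup G n →* KanGroup G m :=
  Monoid.CoprodI.lift fun x =>
    (kanIncl G (simplexYoneda.map θ ≫ x)).comp (G.map (CostructuredArrow.mkPrecomp x θ).op).hom

lemma kanMap_incl {m n : SimplexCategory} (θ : m ⟶ n) (x : simplexYoneda.{u}.obj n ⟶ X)
    (g : G.obj (op (CostructuredArrow.mk x))) :
    kanMap G θ (kanIncl G x g) = kanIncl G (simplexYoneda.map θ ≫ x)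
      (G.map (CostructuredArrow.mkPrecomp x θ).op g) :=
  Monoid.CoprodI.lift_of _ _

/-- An explicit left Kan extension of `G` along `Q_X^op`. -/
def kanObj : SimplicialObject GrpCat.{u} where
  obj k := GrpCat.of (KanGroup G k.unop)
  map θ := GrpCat.ofHom (kanMap G θ.unop)
  map_id k := by
    ext1
    refine kan_hom_ext fun x g => (kanMap_incl G _ x g).trans ?_
    refine (kanIncl_congr G (CostructuredArrow.mkPrecomp x (𝟙 _)) (𝟙 _) rfl g).trans ?_
    exact congrArg (kanIncl G x) (by simp)
  map_comp θ ψ := by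
    ext1
    refine kan_hom_ext fun x g => (kanMap_incl G _ x g).trans ?_
    refine Eq.trans ?_ (congrArg (kanMap G ψ.unop) (kanMap_incl G θ.unop x g)).symm
    refine Eq.trans ?_ (kanMap_incl G ψ.unop _ _).symm
    refine (kanIncl_congr G _ (CostructuredArrow.mkPrecomp _ ψ.unop ≫
      CostructuredArrow.mkPrecomp x θ.unop) rfl g).trans ?_
    refine congrArg (kanIncl G _) ?_
    rw [op_comp, G.map_comp, ConcreteCategory.comp_apply]

variable {G} {G' : (SimplexOver X)ᵒᵖ ⥤ GrpCat.{u}}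

/-- The functoriality of the Kan extension in degree `k`. -/
def kanNatHom (t : G ⟶ G') (k : SimplexCategory) : KanGroup G k →* KanGroup G' k :=
  Monoid.CoprodI.lift fun x => (kanIncl G' x).comp (t.app (op (CostructuredArrow.mk x))).hom

lemma kanNatHom_incl (t : G ⟶ G') {k : SimplexCategory} (x : simplexYoneda.{u}.obj k ⟶ X)
    (g : G.obj (op (CostructuredArrow.mk x))) :
    kanNatHom t k (kanIncl G x g) = kanIncl G' x (t.app (op (CostructuredArrow.mk x)) g) :=
  Monoid.CoprodI.lift_of _ _

/-- The explicit left Kan extension as a functor. -/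
def kan (X : SSet.{u}) :
    ((SimplexOver X)ᵒᵖ ⥤ GrpCat.{u}) ⥤ SimplicialObject GrpCat.{u} where
  obj G := kanObj G
  map {G G'} t :=
    { app := fun k => GrpCat.ofHom (kanNatHom t k.unop)
      naturality := fun m n θ => by
        ext1
        refine kan_hom_ext fun x g => ?_
        refine (congrArg (kanNatHom t n.unop) (kanMap_incl G θ.unop x g)).trans ?_
        refine (kanNatHom_incl t _ _).trans ?_
        refine Eq.trans ?_ (congrArg (kanMap G' θ.unop) (kanNatHom_incl t x g)).symm
        refine Eq.trans ?_ (kanMap_incl G' θ.unop x _).symm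
        exact congrArg (kanIncl G' _) (ConcreteCategory.congr_hom (t.naturality _) g) }
  map_id G := by
    apply NatTrans.ext
    funext k
    ext1
    exact kan_hom_ext fun x g => kanNatHom_incl _ x g
  map_comp t s := by
    apply NatTrans.ext
    funext k
    ext1
    refine kan_hom_ext fun x g => (kanNatHom_incl _ x g).trans ?_
    refine Eq.trans ?_ (congrArg (kanNatHom s k.unop) (kanNatHom_incl t x g)).symm
    exact (kanNatHom_incl s x _).symm

/-- The homomorphisms out of the Kan extension induced by a natural transformation. -/
def kanLift {H : SimplexCategoryᵒᵖ ⥤ GrpCat.{u}} (t : G ⟶ (forgetSimplex X).op ⋙ H)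
    (k : SimplexCategory) : KanGroup G k →* H.obj (op k) :=
  Monoid.CoprodI.lift fun x => (t.app (op (CostructuredArrow.mk x))).hom

lemma kanLift_incl {H : SimplexCategoryᵒᵖ ⥤ GrpCat.{u}} (t : G ⟶ (forgetSimplex X).op ⋙ H)
    {k : SimplexCategory} (x : simplexYoneda.{u}.obj k ⟶ X)
    (g : G.obj (op (CostructuredArrow.mk x))) :
    kanLift t k (kanIncl G x g) = t.app (op (CostructuredArrow.mk x)) g :=
  Monoid.CoprodI.lift_of _ _

/-- The universal property of the explicit left Kan extension. -/
def kanHomEquiv (G : (SimplexOver X)ᵒᵖ ⥤ GrpCat.{u}) (H : SimplexCategoryᵒᵖ ⥤ GrpCat.{u}) :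
    ((kan X).obj G ⟶ H) ≃ (G ⟶ (forgetSimplex X).op ⋙ H) where
  toFun φ :=
    { app := fun d => GrpCat.ofHom
        ((φ.app (op d.unop.left)).hom.comp (kanIncl G d.unop.hom))
      naturality := fun d d' f => by
        ext g
        refine Eq.trans ?_ (ConcreteCategory.congr_hom (φ.naturality f.unop.left.op)
          (kanIncl G d.unop.hom g))
        refine congrArg (φ.app (op d'.unop.left)) ?_
        refine Eq.trans ?_ (kanMap_incl G f.unop.left d.unop.hom g).symm
        -- The simplex at the source of `f.unop` equals the restriction of the one at its target
        -- only through the triangle that `f.unop` satisfies.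
        exact kanIncl_congr G (c := d.unop) f.unop
          (CostructuredArrow.mkPrecomp d.unop.hom f.unop.left) rfl g }
  invFun t :=
    { app := fun k => GrpCat.ofHom (kanLift t k.unop)
      naturality := fun m n θ => by
        ext1
        refine kan_hom_ext fun x g => ?_
        refine (congrArg (kanLift t n.unop) (kanMap_incl G θ.unop x g)).trans ?_
        refine (kanLift_incl t _ _).trans ?_
        refine Eq.trans ?_ (congrArg (H.map θ) (kanLift_incl t x g)).symm
        exact ConcreteCategory.congr_hom
          (t.naturality (CostructuredArrow.mkPrecomp x θ.unop).op) g }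
  left_inv φ := by
    apply NatTrans.ext
    funext k
    ext1
    exact kan_hom_ext fun x g => kanLift_incl _ x g
  right_inv t := by
    apply NatTrans.ext
    funext d
    ext g
    exact kanLift_incl t d.unop.hom g

/-- The explicit left Kan extension is left adjoint to restriction along `Q_X^op`. -/
def kanAdjunction (X : SSet.{u}) :
    kan X ⊣ (Functor.whiskeringLeft _ _ GrpCat.{u}).obj (forgetSimplex X).op :=
  Adjunction.mkOfHomEquiv
    { homEquiv := kanHomEquiv
      homEquiv_naturality_left_symm := fun t s => by
        apply NatTrans.ext
        funext k
        ext1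
        refine kan_hom_ext fun x g => (kanLift_incl (t ≫ s) x g).trans ?_
        refine Eq.trans ?_ (congrArg (kanLift s k.unop) (kanNatHom_incl t x g)).symm
        exact (kanLift_incl s x _).symm
      homEquiv_naturality_right := fun φ t => rfl }

/-- The left Kan extension agrees with the explicit one. -/
noncomputable def kanIsoLan (X : SSet.{u}) : kan X ≅ lanSimplicialGroup X :=
  (kanAdjunction X).leftAdjointUniq ((forgetSimplex X).op.lanAdjunction GrpCat.{u})

end Kan

end GroupDiagram
namespace GroupDiagram

/-! ### The simplicial replacement of a Kan extension -/

section Flatten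

variable {X : SSet.{u}} (G : (SimplexOver X)ᵒᵖ ⥤ GrpCat.{u})

/-- The map `C_m((Δ ↓ X)^op, G) → C_m(Δ^op, Lan G)`. -/
def flattenHom (m : ℕ) :
    Replacement G m →* Replacement (C := SimplexCategoryᵒᵖ) (kanObj G) m :=
  Monoid.CoprodI.lift fun σ => (incl (C := SimplexCategoryᵒᵖ) (kanObj G)
    (σ ⋙ (forgetSimplex X).op)).comp (kanIncl G (σ.obj 0).unop.hom)

lemma flattenHom_incl {m : ℕ} (σ : ComposableArrows (SimplexOver X)ᵒᵖ m) (g : G.obj (σ.obj 0)) :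
    flattenHom G m (incl G σ g) = incl (C := SimplexCategoryᵒᵖ) (kanObj G)
      (σ ⋙ (forgetSimplex X).op) (kanIncl G (σ.obj 0).unop.hom g) :=
  Monoid.CoprodI.lift_of _ _

/-- The lift of a sequence in `Δ^op` to `(Δ ↓ X)^op` starting at a given simplex. -/
def liftChain {m : ℕ} (τ : ComposableArrows SimplexCategoryᵒᵖ m)
    (x : simplexYoneda.{u}.obj (τ.obj 0).unop ⟶ X) : ComposableArrows (SimplexOver X)ᵒᵖ m where
  obj i := op (CostructuredArrow.mk
    (simplexYoneda.{u}.map (τ.map (homOfLE (Fin.zero_le i))).unop ≫ x))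
  map {i j} h := (CostructuredArrow.homMk (τ.map h).unop (by
    refine (Category.assoc _ _ _).symm.trans (congrArg (· ≫ x) ?_)
    refine (simplexYoneda.{u}.map_comp _ _).symm.trans (congrArg simplexYoneda.{u}.map ?_)
    exact congrArg Quiver.Hom.unop (τ.map_comp _ _).symm)).op
  map_id i := by
    apply Quiver.Hom.unop_inj
    apply CostructuredArrow.hom_ext
    exact congrArg Quiver.Hom.unop (τ.map_id i)
  map_comp f g := by
    apply Quiver.Hom.unop_inj
    apply CostructuredArrow.hom_ext
    exact congrArg Quiver.Hom.unop (τ.map_comp f g)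

/-- The map `C_m(Δ^op, Lan G) → C_m((Δ ↓ X)^op, G)`. -/
def unflattenHom (m : ℕ) :
    Replacement (C := SimplexCategoryᵒᵖ) (kanObj G) m →* Replacement G m :=
  Monoid.CoprodI.lift fun τ => (Monoid.CoprodI.lift fun x => (incl G (liftChain τ x)).comp
    -- The lifted chain starts at the restriction of `x` along `τ.map (𝟙 0)`, which is `x` only
    -- propositionally; this map is the comparison.
    (G.map (CostructuredArrow.mkPrecomp x (τ.map (homOfLE (Fin.zero_le 0))).unop).op).hom :
      KanGroup G (τ.obj 0).unop →* Replacement G m)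

lemma unflattenHom_incl {m : ℕ} (τ : ComposableArrows SimplexCategoryᵒᵖ m)
    (x : simplexYoneda.{u}.obj (τ.obj 0).unop ⟶ X) (g : G.obj (op (CostructuredArrow.mk x))) :
    unflattenHom G m (incl (C := SimplexCategoryᵒᵖ) (kanObj G) τ (kanIncl G x g)) =
      incl G (liftChain τ x) (G.map (CostructuredArrow.mkPrecomp x
        (τ.map (homOfLE (Fin.zero_le 0))).unop).op g) :=
  (Monoid.CoprodI.lift_of _ _).trans (Monoid.CoprodI.lift_of _ _)

/-- The lifted chain projects definitionally to `τ`, so only the comparison map at its start has to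
be recognized as an identity. -/
lemma flattenHom_unflattenHom {m : ℕ}
    (y : Replacement (C := SimplexCategoryᵒᵖ) (kanObj G) m) :
    flattenHom G m (unflattenHom G m y) = y := by
  suffices h : (flattenHom G m).comp (unflattenHom G m) = MonoidHom.id _ from
    DFunLike.congr_fun h y
  refine Monoid.CoprodI.ext_hom _ _ fun τ => kan_hom_ext fun x g => ?_
  refine (congrArg (flattenHom G m) (unflattenHom_incl G τ x g)).trans ?_
  refine (flattenHom_incl G _ _).trans ?_
  refine congrArg (incl (C := SimplexCategoryᵒᵖ) (kanObj G) τ) ?_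
  refine (kanIncl_congr G (CostructuredArrow.mkPrecomp x
    (τ.map (homOfLE (Fin.zero_le 0))).unop) (𝟙 _)
    (congrArg Quiver.Hom.unop (τ.map_id 0)) g).trans ?_
  exact congrArg (kanIncl G x) (by simp)

lemma eqToHom_unop_left {d d' : (SimplexOver X)ᵒᵖ} (h : d = d')
    (h' : d'.unop.left = d.unop.left) : (eqToHom h).unop.left = eqToHom h' := by
  subst h
  rfl

/-- Unique lifting: the triangle of the arrow `σ 0 ⟶ σ i` forces the simplex at `i` to be the
restriction of the one at 0. -/
lemma liftChain_comp_forget {m : ℕ} (σ : ComposableArrows (SimplexOver X)ᵒᵖ m) :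
    liftChain (σ ⋙ (forgetSimplex X).op) (σ.obj 0).unop.hom = σ := by
  have hobj (i : Fin (m + 1)) :
      (liftChain (σ ⋙ (forgetSimplex X).op) (σ.obj 0).unop.hom).obj i = σ.obj i :=
    congrArg (fun x => op (CostructuredArrow.mk (Y := (σ.obj i).unop.left) x))
      (CostructuredArrow.w (σ.map (homOfLE (Fin.zero_le i))).unop)
  refine CategoryTheory.Functor.ext hobj fun i j f => ?_
  apply Quiver.Hom.unop_inj
  apply CostructuredArrow.hom_ext
  rw [unop_comp, unop_comp, CostructuredArrow.comp_left, CostructuredArrow.comp_left,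
    eqToHom_unop_left (hobj i) rfl, eqToHom_unop_left (hobj j).symm rfl]
  exact ((Category.id_comp _).trans (Category.comp_id _)).symm

lemma incl_congr {C : Type w} [Category.{v} C] (F : C ⥤ GrpCat.{u}) {m : ℕ}
    {σ τ : ComposableArrows C m} (h : σ = τ) (x : F.obj (τ.obj 0)) :
    incl F σ (F.map (eqToHom (by rw [h])) x) = incl F τ x := by
  subst h
  simp

lemma unflattenHom_flattenHom {m : ℕ} (y : Replacement G m) :
    unflattenHom G m (flattenHom G m y) = y := by
  suffices h : (unflattenHom G m).comp (flattenHom G m) = MonoidHom.id _ from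
    DFunLike.congr_fun h y
  refine replacement_hom_ext fun σ g => ?_
  refine (congrArg (unflattenHom G m) (flattenHom_incl G σ g)).trans ?_
  refine (unflattenHom_incl G _ _ _).trans ?_
  refine Eq.trans ?_ (incl_congr G (liftChain_comp_forget σ) g)
  refine congrArg (fun f => incl G (liftChain (σ ⋙ (forgetSimplex X).op) (σ.obj 0).unop.hom)
    (G.map f g)) ?_
  -- The comparison map and the transport along `liftChain_comp_forget` are both identities in Δ,
  -- and an arrow over X is determined by its underlying map.
  apply Quiver.Hom.unop_inj
  apply CostructuredArrow.hom_ext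
  refine Eq.trans ?_ (eqToHom_unop_left
    (congrArg (fun ρ => ρ.obj 0) (liftChain_comp_forget σ)).symm rfl).symm
  exact congrArg Quiver.Hom.unop ((σ ⋙ (forgetSimplex X).op).map_id 0)

/-- The isomorphism `C_*((Δ ↓ X)^op, G) ≅ C_*(Δ^op, Lan G)`. -/
def flattenIso (X : SSet.{u}) :
    (simplicialReplacement (SimplexOver X)ᵒᵖ :
      ((SimplexOver X)ᵒᵖ ⥤ GrpCat.{u}) ⥤ SimplicialObject GrpCat.{u}) ≅
      kan X ⋙ simplicialReplacement SimplexCategoryᵒᵖ :=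
  NatIso.ofComponents
    (fun G => NatIso.ofComponents
      (fun n => MulEquiv.toGrpIso
        { toFun := flattenHom G n.unop.len
          invFun := unflattenHom G n.unop.len
          left_inv := unflattenHom_flattenHom G
          right_inv := flattenHom_unflattenHom G
          map_mul' := map_mul _ })
      (fun {m n} θ => by
        ext1
        refine replacement_hom_ext fun σ g => ?_
        refine (congrArg (flattenHom G n.unop.len) (replacementMap_incl G θ.unop σ g)).trans ?_
        refine (flattenHom_incl G _ _).trans ?_
        refine Eq.trans ?_ (congrArg (replacementMap (C := SimplexCategoryᵒᵖ) (kanObj G) θ.unop)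
          (flattenHom_incl G σ g)).symm
        refine Eq.trans ?_ (replacementMap_incl (C := SimplexCategoryᵒᵖ) (kanObj G) θ.unop
          (σ ⋙ (forgetSimplex X).op) _).symm
        refine congrArg (incl (C := SimplexCategoryᵒᵖ) (kanObj G) _) ?_
        refine Eq.trans ?_ (kanMap_incl G _ _ _).symm
        -- One side uses the arrow of the chain σ, the other the canonical restriction of its first
        -- simplex; their underlying maps in Δ coincide.
        exact kanIncl_congr G (c := (σ.obj 0).unop) (σ.map _).unop
          (CostructuredArrow.mkPrecomp (σ.obj 0).unop.hom _) rfl g))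
    (fun {G G'} t => by
      apply NatTrans.ext
      funext n
      ext1
      refine replacement_hom_ext fun σ g => ?_
      refine (congrArg (flattenHom G' n.unop.len) (replacementNat_incl t σ g)).trans ?_
      refine (flattenHom_incl G' _ _).trans ?_
      refine Eq.trans ?_ (congrArg (replacementNat (C := SimplexCategoryᵒᵖ) ((kan X).map t)
        n.unop.len) (flattenHom_incl G σ g)).symm
      refine Eq.trans ?_ (replacementNat_incl (C := SimplexCategoryᵒᵖ) ((kan X).map t) _ _).symm
      refine congrArg (incl (C := SimplexCategoryᵒᵖ) (kanObj G') _) ?_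
      exact (kanNatHom_incl t _ g).symm)

end Flatten

end GroupDiagram

theorem mainTheorem6 (X : SSet.{u}) (n : ℕ) :
    Nonempty (GroupDiagram.colimN (GroupDiagram.SimplexOver X)ᵒᵖ n ≅
      GroupDiagram.gabrielZismanHomology X n) ∧
    Nonempty (GroupDiagram.gabrielZismanHomology X n ≅
      GroupDiagram.lanSimplicialGroup X ⋙ GroupDiagram.piFunctor n) :=
  ⟨⟨Functor.isoWhiskerRight (GroupDiagram.flattenIso X) (GroupDiagram.piFunctor n) ≪≫
      Functor.isoWhiskerRight (GroupDiagram.kanIsoLan X)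
        (GroupDiagram.colimN SimplexCategoryᵒᵖ n)⟩,
    ⟨Functor.isoWhiskerLeft (GroupDiagram.lanSimplicialGroup X)
      (GroupDiagram.colimNSimplexIso n).symm⟩⟩
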